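/- Let $\mathfrak A:\mathbb R^2\to\mathbb R^2$ be a (real) vector potential with $\mathfrak A\in L^2_{\mathrm{loc}}(\mathbb R^2;\mathbb R^2)$ and let $p=-\mathrm i\nabla$. Let $D$ be the closure of the operator $\varphi\mapsto(-\mathrm i\partial_j\varphi+\mathfrak A_j\varphi)_{j=1,2}$, $\varphi\in C_0^\infty(\mathbb R^2)$, from $L^2(\mathbb R^2;\mathbb C)$ to $L^2(\mathbb R^2;\mathbb C^2)$, so that $D^*D=(p+\mathfrak A)^2$, and let $T_{\mathfrak A}=|p+\mathfrak A|=\sqrt{D^*D}$ be the magnetic ultra-relativistic kinetic energy, a self-adjoint operator in $L^2(\mathbb R^2;\mathbb C)$. Then $|x|T_{\mathfrak A}+T_{\mathfrak A}|x|\ge 0$ on $C_0^\infty(\mathbb R^2)$ in the sense of quadratic forms: for every complex-valued $\psi\in C_0^\infty(\mathbb R^2)$ both $\psi$ and $|x|\psi$ lie in the domain of $T_{\mathfrak A}$, and $$\langle |x|\psi,\,T_{\mathfrak A}\psi\rangle+\langle\psi,\,T_{\mathfrak A}(|x|\psi)\rangle\ \ge\ 0 .$$ In contrast, in two dimensions the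 corresponding positivity is false for the non-relativistic kinetic energy $T=p^2/2=-\tfrac12\Delta$: there is a $\psi\in C_0^\infty(\mathbb R^2)$ with $$\langle |x|\psi,\,T\psi\rangle+\langle T\psi,\,|x|\psi\rangle\ <\ 0 .$$ -/

import Mathlib

open MeasureTheory
open scoped ContDiff InnerProductSpace ComplexOrder

noncomputable section

section Modulus

variable {H K : Type*} [NormedAddCommGroup H] [InnerProductSpace ℂ H] [CompleteSpace H]
  [NormedAddCommGroup K] [InnerProductSpace ℂ K] [CompleteSpace K]

/-- The projection `J : (u, D u) ↦ u` from the closed graph `G` of an operator `D` between Hilbert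
spaces to the first space. -/
def graphProjection (G : Submodule ℂ (WithLp 2 (H × K))) : G.topologicalClosure →L[ℂ] H :=
  (WithLp.fstL 2 ℂ H K).comp G.topologicalClosure.subtypeL

/-- The resolvent `R = (1 + D* D)⁻¹`, where `D` is the closure of the operator with graph `G`:
`u = R f` is the element of the domain of `D` with `⟨v, u⟩ + ⟨D v, D u⟩ = ⟨v, f⟩` for all `v` in
the domain of `D`. The left side is the inner product of `(v, D v)` and `(u, D u)` in the graph, so
this says that `R = J J*`. -/
def graphResolvent (G : Submodule ℂ (WithLp 2 (H × K))) : H →L[ℂ] H :=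
  (graphProjection G).comp (ContinuousLinearMap.adjoint (graphProjection G))

/-- The graph of the modulus `|D| = √(D* D) = √(R⁻¹ - 1) = (1 - R)^{1/2} R^{-1/2}`, namely the set
of all pairs `(R^{1/2} f, (1 - R)^{1/2} f)`. Here `D` is the closure of the densely defined
operator with graph `G`. -/
def modulusGraph (G : Submodule ℂ (WithLp 2 (H × K))) : Submodule ℂ (H × H) :=
  LinearMap.range
    (((CFC.sqrt (graphResolvent G)).prod (CFC.sqrt (1 - graphResolvent G)) :
      H →L[ℂ] H × H) : H →ₗ[ℂ] H × H)

/-- If `D` is densely defined, then `modulusGraph` is indeed the graph of an operator. -/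
theorem modulusGraph_isGraph (G : Submodule ℂ (WithLp 2 (H × K)))
    (hG : ∀ f : H, (∀ z ∈ G, inner ℂ z.fst f = 0) → f = 0) :
    ∀ z ∈ modulusGraph G, z.1 = 0 → z.2 = 0 := by
  rintro _ ⟨f, rfl⟩ hf
  have h0 : CFC.sqrt (graphResolvent G) f = 0 := hf
  have hR : 0 ≤ graphResolvent G :=
    (ContinuousLinearMap.nonneg_iff_isPositive _).2
      (ContinuousLinearMap.isPositive_self_comp_adjoint (graphProjection G))
  have h1 : graphResolvent G f = 0 := by
    have h := CFC.sqrt_mul_sqrt_self (graphResolvent G) hR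
    rw [← h]
    change CFC.sqrt (graphResolvent G) (CFC.sqrt (graphResolvent G) f) = 0
    rw [h0, map_zero]
  have h2 : ContinuousLinearMap.adjoint (graphProjection G) f = 0 := by
    rw [← inner_self_eq_zero (𝕜 := ℂ), ContinuousLinearMap.adjoint_inner_left]
    change inner ℂ f (graphResolvent G f) = 0
    rw [h1, inner_zero_right]
  have h3 : f = 0 := by
    refine hG f fun z hz => ?_
    have h := ContinuousLinearMap.adjoint_inner_right (graphProjection G)
      ⟨z, G.le_topologicalClosure hz⟩ f
    rw [h2, inner_zero_right] at h
    exact h.symm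
  rw [h3, map_zero]
  rfl

end Modulus

/-- The Euclidean plane `ℝ²`. -/
abbrev Plane : Type := EuclideanSpace ℝ (Fin 2)

/-- The Hilbert space `L²(ℝ²; ℂ)`. -/
abbrev L2Scalar : Type := Lp ℂ 2 (volume : Measure Plane)

/-- The Hilbert space `L²(ℝ²; ℂ²)`. -/
abbrev L2Vector : Type := Lp (EuclideanSpace ℂ (Fin 2)) 2 (volume : Measure Plane)

/-- A real vector potential of class `L²_loc(ℝ²)`. -/
def IsL2Loc (A : Plane → Plane) : Prop :=
  ∀ K : Set Plane, IsCompact K → MemLp A 2 (volume.restrict K)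

/-- The class `C_0^∞(ℝ²)` of smooth compactly supported complex functions. -/
def IsTestFunction (φ : Plane → ℂ) : Prop :=
  ContDiff ℝ ∞ φ ∧ HasCompactSupport φ

/-- `(p + A) φ = (-i ∂_j φ + A_j φ)_{j = 1, 2}`, where `p = -i ∇`. -/
def magneticMomentum (A : Plane → Plane) (φ : Plane → ℂ) (x : Plane) :
    EuclideanSpace ℂ (Fin 2) :=
  WithLp.toLp 2 fun j =>
    -Complex.I * fderiv ℝ φ x (EuclideanSpace.single j 1) + (A x j : ℂ) * φ x

theorem IsTestFunction.zero : IsTestFunction 0 :=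
  ⟨contDiff_const, HasCompactSupport.zero⟩

theorem IsTestFunction.add {φ χ : Plane → ℂ} (hφ : IsTestFunction φ) (hχ : IsTestFunction χ) :
    IsTestFunction (φ + χ) :=
  ⟨hφ.1.add hχ.1, hφ.2.add hχ.2⟩

theorem IsTestFunction.smul {φ : Plane → ℂ} (c : ℂ) (hφ : IsTestFunction φ) :
    IsTestFunction (c • φ) :=
  ⟨hφ.1.const_smul c, hφ.2.smul_left (f := fun _ => c)⟩

theorem IsTestFunction.differentiable {φ : Plane → ℂ} (hφ : IsTestFunction φ) :
    Differentiable ℝ φ :=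
  hφ.1.differentiable (by simp)

theorem magneticMomentum_zero (A : Plane → Plane) : magneticMomentum A 0 = 0 := by
  funext x
  ext j
  simp [magneticMomentum]

theorem magneticMomentum_add (A : Plane → Plane) {φ χ : Plane → ℂ} (hφ : IsTestFunction φ)
    (hχ : IsTestFunction χ) :
    magneticMomentum A (φ + χ) = magneticMomentum A φ + magneticMomentum A χ := by
  funext x
  ext j
  simp only [magneticMomentum, Pi.add_apply, PiLp.add_apply,
    fderiv_add (hφ.differentiable x) (hχ.differentiable x), _root_.add_apply]
  ring

theorem magneticMomentum_smul (A : Plane → Plane) {φ : Plane → ℂ} (c : ℂ)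
    (hφ : IsTestFunction φ) :
    magneticMomentum A (c • φ) = c • magneticMomentum A φ := by
  funext x
  ext j
  simp only [magneticMomentum, Pi.smul_apply, PiLp.smul_apply,
    fderiv_const_smul (hφ.differentiable x) c, _root_.smul_apply, smul_eq_mul]
  ring

/-- The graph of `p + A` on `C_0^∞(ℝ²)`, as an operator from `L²(ℝ²; ℂ)` to `L²(ℝ²; ℂ²)`.
(If `A` is in `L²_loc`, then `(p + A) φ` is in `L²` for every test function `φ`.) -/
def magneticMomentumGraph (A : Plane → Plane) : Submodule ℂ (WithLp 2 (L2Scalar × L2Vector)) where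
  carrier := {z | ∃ φ : Plane → ℂ, IsTestFunction φ ∧
    (z.fst : Plane → ℂ) =ᵐ[volume] φ ∧
    (z.snd : Plane → EuclideanSpace ℂ (Fin 2)) =ᵐ[volume] magneticMomentum A φ}
  zero_mem' := by
    refine ⟨0, IsTestFunction.zero, ?_, ?_⟩
    · exact Lp.coeFn_zero _ _ _
    · rw [magneticMomentum_zero]
      exact Lp.coeFn_zero _ _ _
  add_mem' := by
    rintro z w ⟨φ, hφ, hz1, hz2⟩ ⟨χ, hχ, hw1, hw2⟩
    refine ⟨φ + χ, hφ.add hχ, ?_, ?_⟩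
    · exact (Lp.coeFn_add z.fst w.fst).trans (hz1.add hw1)
    · rw [magneticMomentum_add A hφ hχ]
      exact (Lp.coeFn_add z.snd w.snd).trans (hz2.add hw2)
  smul_mem' := by
    rintro c z ⟨φ, hφ, hz1, hz2⟩
    refine ⟨c • φ, hφ.smul c, ?_, ?_⟩
    · exact (Lp.coeFn_smul c z.fst).trans (hz1.const_smul c)
    · rw [magneticMomentum_smul A c hφ]
      exact (Lp.coeFn_smul c z.snd).trans (hz2.const_smul c)

/-- The magnetic ultra-relativistic kinetic energy `T_A = |p + A| = |D| = √(D* D)`, where `D` is the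
closure of `p + A` on `C_0^∞(ℝ²)`. It is an unbounded operator in `L²(ℝ²; ℂ)`. -/
def kineticEnergy (A : Plane → Plane) : L2Scalar →ₗ.[ℂ] L2Scalar :=
  (modulusGraph (magneticMomentumGraph A)).toLinearPMap

/-- If `A` is in `L²_loc`, then `(p + A) φ` is in `L²` for every test function `φ`. -/
theorem memLp_magneticMomentum {A : Plane → Plane} (hA : IsL2Loc A) {φ : Plane → ℂ}
    (hφ : IsTestFunction φ) : MemLp (magneticMomentum A φ) 2 (volume : Measure Plane) := by
  rw [memLp_piLp_iff]
  intro j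
  have h1 : MemLp (fun x => fderiv ℝ φ x (EuclideanSpace.single j 1)) 2
      (volume : Measure Plane) :=
    ((hφ.1.continuous_fderiv (by simp)).clm_apply continuous_const).memLp_of_hasCompactSupport
      (hφ.2.fderiv_apply ℝ _)
  have h2 : MemLp (fun x => (A x j : ℂ) * φ x) 2 (volume : Measure Plane) := by
    have hK : IsCompact (tsupport φ) := hφ.2
    have h3 : MemLp (fun x => (A x j : ℂ)) 2 (volume.restrict (tsupport φ)) :=
      (memLp_piLp_iff.1 (hA _ hK) j).ofReal
    obtain ⟨C, hC⟩ := hφ.1.continuous.bounded_above_of_compact_support hφ.2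
    have h4 : MemLp (fun x => (A x j : ℂ) * φ x) 2 (volume.restrict (tsupport φ)) :=
      h3.of_le_mul (c := C) (h3.1.mul hφ.1.continuous.aestronglyMeasurable)
        (Filter.Eventually.of_forall fun x => by
          rw [norm_mul, mul_comm]
          exact mul_le_mul_of_nonneg_right (hC x) (norm_nonneg _))
    rw [← memLp_indicator_iff_restrict hK.isClosed.measurableSet] at h4
    rwa [Set.indicator_eq_self.2] at h4
    intro x hx
    refine subset_tsupport φ ?_
    intro h
    exact hx (by simp [h])
  exact (h1.const_mul (-Complex.I)).add h2

/-- If `A` is in `L²_loc`, then `p + A` on `C_0^∞(ℝ²)` is densely defined in `L²(ℝ²; ℂ)`. -/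
theorem magneticMomentumGraph_dense {A : Plane → Plane} (hA : IsL2Loc A) (f : L2Scalar)
    (hf : ∀ z ∈ magneticMomentumGraph A, inner ℂ z.fst f = 0) : f = 0 := by
  have hloc : LocallyIntegrable (f : Plane → ℂ) volume :=
    (Lp.memLp f).locallyIntegrable (by norm_num)
  refine Lp.eq_zero_iff_ae_eq_zero.2 (ae_eq_zero_of_integral_contDiff_smul_eq_zero hloc ?_)
  intro g hg hgc
  have hφ : IsTestFunction fun x => (g x : ℂ) :=
    ⟨Complex.ofRealCLM.contDiff.comp hg, hgc.comp_left (g := Complex.ofReal) Complex.ofReal_zero⟩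
  have hφ2 : MemLp (fun x => (g x : ℂ)) 2 (volume : Measure Plane) :=
    hφ.1.continuous.memLp_of_hasCompactSupport hφ.2
  have h := hf (WithLp.toLp 2 (hφ2.toLp, (memLp_magneticMomentum hA hφ).toLp))
    ⟨_, hφ, hφ2.coeFn_toLp, (memLp_magneticMomentum hA hφ).coeFn_toLp⟩
  rw [L2.inner_def] at h
  rw [← h]
  refine integral_congr_ae ?_
  filter_upwards [hφ2.coeFn_toLp] with x hx
  change g x • f x = inner ℂ ((hφ2.toLp : L2Scalar) x) (f x)
  rw [hx, RCLike.inner_apply, Complex.conj_ofReal, Complex.real_smul, mul_comm]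

/-- `kineticEnergy A` has the graph `modulusGraph (magneticMomentumGraph A)`. -/
theorem kineticEnergy_graph {A : Plane → Plane} (hA : IsL2Loc A) :
    (kineticEnergy A).graph = modulusGraph (magneticMomentumGraph A) :=
  Submodule.toLinearPMap_graph_eq _ fun z hz =>
    modulusGraph_isGraph _ (magneticMomentumGraph_dense hA) z hz

end

/-! Write `|D|` for the modulus and `u_t = exp (-t |D|) ψ`. The half-line `t > 0` is used as a third
coordinate: with `ε > 0`, let `w(x, t) = (ε + (|x|² + t²)^{-1/2})⁻¹`, a bounded weight whose
reciprocal is harmonic in the three variables `(x, t)`. Hence `w Δw = 2 |∇w|²` in three dimensions,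
and this makes `N(t) = ⟨w_t u_t, u_t⟩` convex. Indeed `N''` contains `2 Re ⟨w u, |D|² u⟩ = 2 Re ⟨D(w
u), D u⟩`. The commutator of `D` with `w` is `-i ∇w`, which does not involve the potential, and one
integration by parts turns the cross term into the planar Laplacian of `w` plus twice the opposite
cross term. After multiplication by `w` the density is `2 |∂_t w u - w |D| u|² + 2 |-i ∇w u + w D
u|²` (`weighted_square_nonneg`, `planeWeight_convexity`).

Since `N` is also bounded, `N' ≤ 0`, that is `2 Re ⟨w u, |D| u⟩ ≥ ⟨∂_t w u, u⟩ ≥ 0`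
(`re_inner_weight_modulus_nonneg`). The time of the weight and the time of the semigroup may differ
by a constant, so the semigroup time can tend to zero while the weight stays smooth and bounded.
Finally `ε` and the height tend to zero together, and `w` tends to `|x|`. Convergence of `w ψ` and
`D(w ψ)` puts `|x| ψ` into the domain of the closed operator `D`, hence into the domain of `|D|`
(`exists_tendsto_mul_norm`, `exists_mem_modulusGraph`). By symmetry of `|D|` the sum in the theorem
is twice the real part of one term.

All functions of `|D|` are functions of the bounded resolvent `R = (1 + D* D)⁻¹`, and `D* D` enters
only in weak form, through pairs in the closed graph of `D`.

For the non-relativistic energy the obstruction is `|x|^{-1/2}`: its Laplacian is `|x|^{-5/2} / 4 >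
0`, so `∫ |x| ψ Δψ` is a positive, logarithmically divergent integral. A slow cutoff in `log |x|`
costs less than this gain (`exists_log_profile`). -/

noncomputable section

/-! ### Taylor remainders and differentiability in norm -/

section Taylor

/-- The mean value inequality is applied to `f₁` and then to `f` minus its linear part, which gives
`C` in place of the sharp `C / 2`. Only uniformity matters: one `C` serves for all points of a
spectrum or of the plane, so pointwise derivatives become derivatives in operator norm. -/
theorem abs_taylor_le {f f₁ f₂ : ℝ → ℝ} {a C : ℝ}
    (h₀ : ∀ t, a < t → HasDerivAt f (f₁ t) t) (h₁ : ∀ t, a < t → HasDerivAt f₁ (f₂ t) t)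
    (hC : ∀ t, a < t → |f₂ t| ≤ C) {s t : ℝ} (hs : a < s) (ht : a < t) :
    |f s - f t - (s - t) * f₁ t| ≤ C * (s - t) ^ 2 := by
  have hsub : ∀ u ∈ Set.uIcc t s, a < u := fun u hu => (lt_min ht hs).trans_le hu.1
  have hC0 : 0 ≤ C := (abs_nonneg _).trans (hC t ht)
  have hlip : ∀ u ∈ Set.uIcc t s, |f₁ u - f₁ t| ≤ C * |s - t| := by
    intro u hu
    have h := Convex.norm_image_sub_le_of_norm_hasDerivWithin_le (f := f₁) (f' := f₂)
      (s := Set.uIcc t s) (C := C) (fun x hx => (h₁ x (hsub x hx)).hasDerivWithinAt)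
      (fun x hx => hC x (hsub x hx)) (convex_uIcc t s) Set.left_mem_uIcc hu
    refine h.trans (mul_le_mul_of_nonneg_left ?_ hC0)
    exact Set.abs_sub_left_of_mem_uIcc hu
  have h := Convex.norm_image_sub_le_of_norm_hasDerivWithin_le
    (f := fun u => f u - u * f₁ t) (f' := fun u => f₁ u - 1 * f₁ t)
    (s := Set.uIcc t s) (C := C * |s - t|)
    (fun x hx => ((h₀ x (hsub x hx)).sub ((hasDerivAt_id x).mul_const _)).hasDerivWithinAt)
    (fun x hx => by simpa using hlip x hx) (convex_uIcc t s) Set.left_mem_uIcc Set.right_mem_uIcc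
  calc |f s - f t - (s - t) * f₁ t| = ‖(f s - s * f₁ t) - (f t - t * f₁ t)‖ := by
        rw [Real.norm_eq_abs]; congr 1; ring
    _ ≤ C * |s - t| * ‖s - t‖ := h
    _ = C * (s - t) ^ 2 := by rw [Real.norm_eq_abs, mul_assoc, ← pow_two, sq_abs]

theorem hasDerivAt_of_norm_sub_le_sq {E : Type*} [NormedAddCommGroup E] [NormedSpace ℝ E]
    {F : ℝ → E} {F' : E} {a C t : ℝ} (ht : a < t)
    (h : ∀ s, a < s → ‖F s - F t - (s - t) • F'‖ ≤ C * (s - t) ^ 2) : HasDerivAt F F' t := by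
  rw [hasDerivAt_iff_isLittleO]
  have hO : (fun s => F s - F t - (s - t) • F') =O[nhds t] fun s => (s - t) ^ 2 := by
    refine Asymptotics.IsBigO.of_bound C ?_
    filter_upwards [lt_mem_nhds ht] with s hs
    rw [Real.norm_of_nonneg (sq_nonneg _)]
    exact h s hs
  refine hO.trans_isLittleO ?_
  have h1 : (fun s : ℝ => s - t) =o[nhds t] fun _ => (1 : ℝ) := by
    rw [Asymptotics.isLittleO_one_iff]
    have : Filter.Tendsto (fun s : ℝ => s - t) (nhds t) (nhds (t - t)) :=
      (continuous_id.sub continuous_const).tendsto t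
    simpa using this
  have h2 := h1.mul_isBigO (Asymptotics.isBigO_refl (fun s : ℝ => s - t) (nhds t))
  simpa [pow_two] using h2

end Taylor

/-! ### The semigroup of the modulus as a function of the resolvent -/

section HeatSymbol

/-- The eigenvalue `√(r⁻¹ - 1)` of the modulus `|D|` as a function of the eigenvalue `r` of the
resolvent `(1 + D* D)⁻¹`. -/
def modulusSymbol (r : ℝ) : ℝ := √(r⁻¹ - 1)

/-- The symbol of `|D| ^ i * exp (-t |D|)`, as a function of the resolvent. -/
def heatSymbol (i : ℕ) (t r : ℝ) : ℝ :=
  if r ≤ 0 then 0 else modulusSymbol r ^ i * Real.exp (-(t * modulusSymbol r))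

theorem modulusSymbol_nonneg (r : ℝ) : 0 ≤ modulusSymbol r := Real.sqrt_nonneg _

theorem heatSymbol_nonneg (i : ℕ) (t r : ℝ) : 0 ≤ heatSymbol i t r := by
  unfold heatSymbol
  split_ifs
  · exact le_rfl
  · exact mul_nonneg (pow_nonneg (modulusSymbol_nonneg r) i) (Real.exp_nonneg _)

/-- As `r` decreases to `0` the eigenvalue of `|D|` tends to infinity and the exponential beats the
power, so the value `0` for `r ≤ 0` is the continuous extension. Thus the continuous functional
calculus of `R` applies although `|D|` is unbounded and `0` may lie in the spectrum of `R`. -/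
theorem continuous_heatSymbol (i : ℕ) {t : ℝ} (ht : 0 < t) : Continuous (heatSymbol i t) := by
  rw [continuous_iff_continuousAt]
  intro r
  rcases lt_trichotomy r 0 with hr | rfl | hr
  · have h : heatSymbol i t =ᶠ[nhds r] fun _ => 0 := by
      filter_upwards [gt_mem_nhds hr] with s hs
      exact if_pos hs.le
    exact continuousAt_const.congr h.symm
  · have h0 : heatSymbol i t 0 = 0 := if_pos le_rfl
    rw [ContinuousAt, h0, ← nhdsLE_sup_nhdsGT (0 : ℝ), Filter.tendsto_sup, nhdsLE_sup_nhdsGT]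
    constructor
    · refine tendsto_const_nhds.congr' ?_
      filter_upwards [self_mem_nhdsWithin] with s hs
      exact (if_pos hs).symm
    · have h1 : Filter.Tendsto modulusSymbol (nhdsWithin 0 (Set.Ioi 0)) Filter.atTop :=
        Real.tendsto_sqrt_atTop.comp (Filter.tendsto_atTop_add_const_right _ (-1 : ℝ)
          tendsto_inv_nhdsGT_zero)
      have h2 : Filter.Tendsto (fun y : ℝ => t⁻¹ ^ i * ((t * y) ^ i * Real.exp (-(t * y))))
          Filter.atTop (nhds (t⁻¹ ^ i * 0)) :=
        ((Real.tendsto_pow_mul_exp_neg_atTop_nhds_zero i).comp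
          (Filter.tendsto_id.const_mul_atTop ht)).const_mul _
      rw [mul_zero] at h2
      refine (h2.comp h1).congr' ?_
      filter_upwards [self_mem_nhdsWithin] with s hs
      have hs' : ¬ s ≤ 0 := not_le.2 hs
      simp only [Function.comp, heatSymbol, if_neg hs', ← mul_assoc, ← mul_pow,
        inv_mul_cancel₀ ht.ne', one_mul]
  · have h : heatSymbol i t =ᶠ[nhds r]
        fun r => √(r⁻¹ - 1) ^ i * Real.exp (-(t * √(r⁻¹ - 1))) := by
      filter_upwards [lt_mem_nhds hr] with s hs
      exact if_neg (not_le.2 hs)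
    refine ContinuousAt.congr ?_ h.symm
    have hr' : r ≠ 0 := hr.ne'
    fun_prop (disch := assumption)

theorem hasDerivAt_heatSymbol (i : ℕ) (r t : ℝ) :
    HasDerivAt (fun t => heatSymbol i t r) (-heatSymbol (i + 1) t r) t := by
  unfold heatSymbol
  split_ifs
  · simpa using hasDerivAt_const t (0 : ℝ)
  · have h := (((hasDerivAt_id t).mul_const (modulusSymbol r)).neg.exp).const_mul
      (modulusSymbol r ^ i)
    convert! h using 1
    simp only [id, Pi.neg_apply]
    ring

/-- A single term of the exponential series, `(a y)^i / i! ≤ exp (a y)`, gives a bound independent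
of the spectral parameter and of `t ≥ a`. -/
theorem heatSymbol_le (i : ℕ) {a t : ℝ} (ha : 0 < a) (hat : a ≤ t) (r : ℝ) :
    heatSymbol i t r ≤ i.factorial / a ^ i := by
  unfold heatSymbol
  split_ifs
  · positivity
  · set y := modulusSymbol r
    have hy : 0 ≤ y := modulusSymbol_nonneg r
    have h1 : (a * y) ^ i / i.factorial ≤ Real.exp (a * y) :=
      Real.pow_div_factorial_le_exp (a * y) (by positivity) i
    have h2 : Real.exp (-(t * y)) ≤ Real.exp (-(a * y)) := by
      gcongr
    rw [le_div_iff₀ (by positivity)]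
    calc y ^ i * Real.exp (-(t * y)) * a ^ i ≤ y ^ i * Real.exp (-(a * y)) * a ^ i := by gcongr
      _ = (a * y) ^ i * Real.exp (-(a * y)) := by rw [mul_pow]; ring
      _ ≤ (i.factorial * Real.exp (a * y)) * Real.exp (-(a * y)) := by
          gcongr
          rw [div_le_iff₀ (by positivity)] at h1
          linarith
      _ = i.factorial := by rw [mul_assoc, ← Real.exp_add]; simp

end HeatSymbol

/-! ### Norm derivatives and strong continuity of the semigroup -/

section HeatOperator

variable {H : Type*} [NormedAddCommGroup H] [InnerProductSpace ℂ H] [CompleteSpace H]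

/-- The operator `|D| ^ i * exp (-t |D|)`, where `R = (1 + D* D)⁻¹`. -/
def heatOperator (R : H →L[ℂ] H) (i : ℕ) (t : ℝ) : H →L[ℂ] H := cfc (heatSymbol i t) R

variable {R : H →L[ℂ] H}

theorem norm_heatOperator_zero_le {t : ℝ} (ht : 0 < t) : ‖heatOperator R 0 t‖ ≤ 1 := by
  refine norm_cfc_le zero_le_one fun r _ => ?_
  rw [Real.norm_of_nonneg (heatSymbol_nonneg _ _ _)]
  simpa using heatSymbol_le 0 ht le_rfl r

theorem hasDerivAt_heatOperator (hR : 0 ≤ R) (i : ℕ) {t : ℝ} (ht : 0 < t) :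
    HasDerivAt (heatOperator R i) (-heatOperator R (i + 1) t) t := by
  have hsa : IsSelfAdjoint R := .of_nonneg hR
  -- The constant bounds the second `t`-derivative, the symbol of order `i + 2`, for all times
  -- beyond `t / 2`; the functional calculus passes it to the operators.
  refine hasDerivAt_of_norm_sub_le_sq (a := t / 2) (C := (i + 2).factorial / (t / 2) ^ (i + 2))
    (by linarith) fun s hs => ?_
  have hs0 : 0 < s := by linarith
  have h : heatOperator R i s - heatOperator R i t - (s - t) • -heatOperator R (i + 1) t
      = cfc (fun r => heatSymbol i s r - heatSymbol i t r - (s - t) * -heatSymbol (i + 1) t r) R := by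
    have c1 := (continuous_heatSymbol i hs0).continuousOn (s := spectrum ℝ R)
    have c2 := (continuous_heatSymbol i ht).continuousOn (s := spectrum ℝ R)
    have c3 := (continuous_heatSymbol (i + 1) ht).continuousOn (s := spectrum ℝ R)
    have c4 : ContinuousOn (fun r => -heatSymbol (i + 1) t r) (spectrum ℝ R) := c3.neg
    rw [cfc_sub (fun r => heatSymbol i s r - heatSymbol i t r)
        (fun r => (s - t) * -heatSymbol (i + 1) t r) R (c1.sub c2) (continuousOn_const.mul c4),
      cfc_sub _ _ R c1 c2, cfc_const_mul (s - t) (fun r => -heatSymbol (i + 1) t r) R c4, cfc_neg]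
    rfl
  rw [h]
  refine norm_cfc_le (by positivity) fun r _ => ?_
  exact abs_taylor_le (f := fun t => heatSymbol i t r) (f₁ := fun t => -heatSymbol (i + 1) t r)
    (f₂ := fun t => - -heatSymbol (i + 2) t r) (a := t / 2)
    (fun u _ => hasDerivAt_heatSymbol i r u) (fun u _ => (hasDerivAt_heatSymbol (i + 1) r u).neg)
    (fun u hu => by
      rw [neg_neg, abs_of_nonneg (heatSymbol_nonneg _ _ _)]
      exact heatSymbol_le (i + 2) (by linarith) hu.le r) hs (by linarith)

theorem spectrum_mem_Icc (h0 : 0 ≤ R) (h1 : R ≤ 1) {r : ℝ} (hr : r ∈ spectrum ℝ R) :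
    0 ≤ r ∧ r ≤ 1 :=
  ⟨spectrum_nonneg_of_nonneg h0 hr, (CFC.le_one_iff (R := ℝ) R (.of_nonneg h0)).1 h1 r hr⟩

theorem modulusSymbol_sq {r : ℝ} (hr : 0 < r) (hr1 : r ≤ 1) : modulusSymbol r ^ 2 = r⁻¹ - 1 :=
  Real.sq_sqrt (sub_nonneg.2 ((one_le_inv₀ hr).2 hr1))

/-- This is `(1 + |D|²)⁻¹ (1 + |D|²) exp (-t |D|) = exp (-t |D|)`. It exhibits vectors smoothed by
the semigroup as values of the resolvent, hence as first components of the closed graph. -/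
theorem comp_heatOperator_zero_add_two (h0 : 0 ≤ R) (h1 : R ≤ 1) {t : ℝ} (ht : 0 < t) :
    R * (heatOperator R 0 t + heatOperator R 2 t) = heatOperator R 0 t := by
  have hsa : IsSelfAdjoint R := .of_nonneg h0
  have c0 := (continuous_heatSymbol 0 ht).continuousOn (s := spectrum ℝ R)
  have c2 := (continuous_heatSymbol 2 ht).continuousOn (s := spectrum ℝ R)
  have h : R * (heatOperator R 0 t + heatOperator R 2 t)
      = cfc (fun r => r * (heatSymbol 0 t r + heatSymbol 2 t r)) R := by
    rw [cfc_mul (fun r => r) (fun r => heatSymbol 0 t r + heatSymbol 2 t r) R continuousOn_id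
      (c0.add c2), cfc_add (a := R) _ _ c0 c2, cfc_id' ℝ R]
    rfl
  rw [h, heatOperator]
  refine cfc_congr fun r hr => ?_
  obtain ⟨hr0, hr1⟩ := spectrum_mem_Icc h0 h1 hr
  rcases hr0.eq_or_lt with rfl | hr0
  · simp [heatSymbol]
  · simp only [heatSymbol, if_neg (not_le.2 hr0), modulusSymbol_sq hr0 hr1]
    field_simp
    ring

theorem sqrt_eq_cfc (h0 : 0 ≤ R) : CFC.sqrt R = cfc Real.sqrt R := by
  have hsa : IsSelfAdjoint R := .of_nonneg h0
  refine CFC.sqrt_unique ?_ (cfc_nonneg fun r _ => Real.sqrt_nonneg r)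
  rw [← cfc_mul _ _ R Real.continuous_sqrt.continuousOn Real.continuous_sqrt.continuousOn]
  conv_rhs => rw [← cfc_id' ℝ R]
  exact cfc_congr fun r hr => Real.mul_self_sqrt (spectrum_nonneg_of_nonneg h0 hr)

theorem sqrt_one_sub_eq_cfc (h0 : 0 ≤ R) (h1 : R ≤ 1) :
    CFC.sqrt (1 - R) = cfc (fun r : ℝ => √(1 - r)) R := by
  have hsa : IsSelfAdjoint R := .of_nonneg h0
  have c : ContinuousOn (fun r : ℝ => √(1 - r)) (spectrum ℝ R) := by fun_prop
  refine CFC.sqrt_unique ?_ (cfc_nonneg fun r _ => Real.sqrt_nonneg _)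
  rw [← cfc_mul _ _ R c c]
  have h : 1 - R = cfc (fun r : ℝ => 1 - r) R := by
    rw [cfc_sub (fun _ : ℝ => (1 : ℝ)) (fun r => r) R continuousOn_const continuousOn_id,
      cfc_const_one ℝ R, cfc_id' ℝ R]
  rw [h]
  exact cfc_congr fun r hr => Real.mul_self_sqrt (sub_nonneg.2 (spectrum_mem_Icc h0 h1 hr).2)

/-- On the spectrum `|D| R^{1/2} = (1 - R)^{1/2}`. Thus `|D| exp (-t |D|)`, applied to the first
component of a pair in the graph of `|D|`, is the semigroup applied to the second. -/
theorem heatOperator_one_mul_sqrt (h0 : 0 ≤ R) (h1 : R ≤ 1) {t : ℝ} (ht : 0 < t) :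
    heatOperator R 1 t * CFC.sqrt R = heatOperator R 0 t * CFC.sqrt (1 - R) := by
  rw [sqrt_eq_cfc h0, sqrt_one_sub_eq_cfc h0 h1, heatOperator, heatOperator,
    ← cfc_mul _ _ R (continuous_heatSymbol 1 ht).continuousOn Real.continuous_sqrt.continuousOn,
    ← cfc_mul _ _ R (continuous_heatSymbol 0 ht).continuousOn (by fun_prop)]
  refine cfc_congr fun r hr => ?_
  obtain ⟨hr0, hr1⟩ := spectrum_mem_Icc h0 h1 hr
  rcases hr0.eq_or_lt with rfl | hr0
  · simp [heatSymbol]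
  · have h : modulusSymbol r * √r = √(1 - r) := by
      rw [modulusSymbol, ← Real.sqrt_mul' _ hr0.le]
      congr 1
      field_simp
    simp only [heatSymbol, if_neg (not_le.2 hr0), pow_one, pow_zero, one_mul, ← h]
    ring

/-- With `y` the eigenvalue of `|D|`, `(1 - exp (-t y)) √r ≤ t y √r = t √(1 - r) ≤ t`: on the range
of `R^{1/2}` the semigroup converges at a linear rate. Density and contractivity extend the
convergence, without rate, to all vectors. -/
theorem norm_heatOperator_zero_mul_sqrt_sub_le (h0 : 0 ≤ R) (h1 : R ≤ 1) {t : ℝ} (ht : 0 < t) :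
    ‖heatOperator R 0 t * CFC.sqrt R - CFC.sqrt R‖ ≤ t := by
  have c := (continuous_heatSymbol 0 ht).continuousOn (s := spectrum ℝ R)
  have cs := Real.continuous_sqrt.continuousOn (s := spectrum ℝ R)
  rw [sqrt_eq_cfc h0, heatOperator, ← cfc_mul _ _ R c cs,
    ← cfc_sub (fun r => heatSymbol 0 t r * √r) (fun r => √r) R (c.mul cs) cs]
  refine norm_cfc_le ht.le fun r hr => ?_
  obtain ⟨hr0, hr1⟩ := spectrum_mem_Icc h0 h1 hr
  rcases hr0.eq_or_lt with rfl | hr0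
  · simp [heatSymbol, ht.le]
  · have h : modulusSymbol r * √r = √(1 - r) := by
      rw [modulusSymbol, ← Real.sqrt_mul' _ hr0.le]
      congr 1
      field_simp
    have h2 : √(1 - r) ≤ 1 := Real.sqrt_le_one.2 (by linarith)
    have hy := modulusSymbol_nonneg r
    simp only [heatSymbol, if_neg (not_le.2 hr0), pow_zero, one_mul]
    have h3 : 1 - t * modulusSymbol r ≤ Real.exp (-(t * modulusSymbol r)) := by
      linarith [Real.add_one_le_exp (-(t * modulusSymbol r))]
    have h4 : Real.exp (-(t * modulusSymbol r)) ≤ 1 :=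
      Real.exp_le_one_iff.2 (neg_nonpos.2 (mul_nonneg ht.le hy))
    rw [Real.norm_eq_abs, abs_sub_comm, abs_of_nonneg (by nlinarith [Real.sqrt_nonneg r])]
    calc √r - Real.exp (-(t * modulusSymbol r)) * √r
        = (1 - Real.exp (-(t * modulusSymbol r))) * √r := by ring
      _ ≤ (t * modulusSymbol r) * √r := by gcongr; linarith
      _ = t * √(1 - r) := by rw [mul_assoc, h]
      _ ≤ t := mul_le_of_le_one_right ht.le h2

theorem tendsto_heatOperator_zero (h0 : 0 ≤ R) (h1 : R ≤ 1)
    (hd : DenseRange (CFC.sqrt R : H →L[ℂ] H)) (x : H) :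
    Filter.Tendsto (fun t => heatOperator R 0 t x) (nhdsWithin 0 (Set.Ioi 0)) (nhds x) := by
  rw [Metric.tendsto_nhds]
  intro ε hε
  obtain ⟨y, hy⟩ := hd.exists_dist_lt x (ε := ε / 3) (by positivity)
  have ht : ∀ᶠ t in nhdsWithin (0 : ℝ) (Set.Ioi 0), t * ‖y‖ < ε / 3 := by
    have : Filter.Tendsto (fun t : ℝ => t * ‖y‖) (nhds 0) (nhds (0 * ‖y‖)) :=
      (continuous_id.mul continuous_const).tendsto 0
    rw [zero_mul] at this
    exact nhdsWithin_le_nhds (this.eventually_lt_const (by positivity))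
  filter_upwards [ht, self_mem_nhdsWithin] with t ht ht0
  set z := CFC.sqrt R y
  have e1 : ‖heatOperator R 0 t (x - z)‖ ≤ dist x z := by
    rw [dist_eq_norm]
    exact (ContinuousLinearMap.le_of_opNorm_le _ (norm_heatOperator_zero_le ht0) _).trans_eq
      (one_mul _)
  have e2 : ‖heatOperator R 0 t z - z‖ ≤ t * ‖y‖ :=
    ContinuousLinearMap.le_of_opNorm_le _ (norm_heatOperator_zero_mul_sqrt_sub_le h0 h1 ht0) y
  rw [dist_eq_norm]
  have e3 : heatOperator R 0 t x - x
      = heatOperator R 0 t (x - z) + (heatOperator R 0 t z - z) + (z - x) := by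
    rw [map_sub]; abel
  rw [e3]
  have e4 : ‖z - x‖ = dist x z := by rw [dist_comm, dist_eq_norm]
  linarith [norm_add₃_le (a := heatOperator R 0 t (x - z)) (b := heatOperator R 0 t z - z)
    (c := z - x)]

end HeatOperator

/-! ### The range of the square root of `J J*` -/

section CompAdjoint

variable {E H : Type*} [NormedAddCommGroup E] [InnerProductSpace ℂ E] [CompleteSpace E]
  [NormedAddCommGroup H] [InnerProductSpace ℂ H] [CompleteSpace H]

theorem comp_adjoint_le_one (J : E →L[ℂ] H) (hJ : ‖J‖ ≤ 1) :
    J.comp (ContinuousLinearMap.adjoint J) ≤ 1 := by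
  have h0 : 0 ≤ J.comp (ContinuousLinearMap.adjoint J) :=
    (ContinuousLinearMap.nonneg_iff_isPositive _).2
      (ContinuousLinearMap.isPositive_self_comp_adjoint J)
  refine (CStarAlgebra.norm_le_one_iff_of_nonneg _ h0).1 ?_
  refine (ContinuousLinearMap.opNorm_comp_le _ _).trans ?_
  rw [LinearIsometryEquiv.norm_map]
  exact mul_le_one₀ hJ (norm_nonneg _) hJ

theorem sqrt_apply_sqrt_apply {R : H →L[ℂ] H} (h0 : 0 ≤ R) (x : H) :
    CFC.sqrt R (CFC.sqrt R x) = R x :=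
  congrArg (fun B : H →L[ℂ] H => B x) (CFC.sqrt_mul_sqrt_self R h0)

theorem inner_sqrt_apply (R : H →L[ℂ] H) (x y : H) :
    ⟪CFC.sqrt R x, y⟫_ℂ = ⟪x, CFC.sqrt R y⟫_ℂ := by
  have h : IsSelfAdjoint (CFC.sqrt R) := .of_nonneg (CFC.sqrt_nonneg R)
  rw [← ContinuousLinearMap.adjoint_inner_right, ← ContinuousLinearMap.star_eq_adjoint, h.star_eq]

theorem norm_sqrt_comp_adjoint_apply (J : E →L[ℂ] H) (x : H) :
    ‖CFC.sqrt (J.comp (ContinuousLinearMap.adjoint J)) x‖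
      = ‖ContinuousLinearMap.adjoint J x‖ := by
  have h0 : 0 ≤ J.comp (ContinuousLinearMap.adjoint J) :=
    (ContinuousLinearMap.nonneg_iff_isPositive _).2
      (ContinuousLinearMap.isPositive_self_comp_adjoint J)
  have h : ⟪CFC.sqrt (J.comp (ContinuousLinearMap.adjoint J)) x,
      CFC.sqrt (J.comp (ContinuousLinearMap.adjoint J)) x⟫_ℂ
      = ⟪ContinuousLinearMap.adjoint J x, ContinuousLinearMap.adjoint J x⟫_ℂ := by
    rw [inner_sqrt_apply, sqrt_apply_sqrt_apply h0, ContinuousLinearMap.adjoint_inner_left]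
    rfl
  rw [inner_self_eq_norm_sq_to_K, inner_self_eq_norm_sq_to_K] at h
  exact (sq_eq_sq₀ (norm_nonneg _) (norm_nonneg _)).1 (by exact_mod_cast h)

/-- The range of `J` is contained in the range of `√(J J*)`. -/
theorem exists_sqrt_comp_adjoint_apply_eq (J : E →L[ℂ] H)
    (hJ : ∀ x, ContinuousLinearMap.adjoint J x = 0 → x = 0) (w : E) :
    ∃ u, CFC.sqrt (J.comp (ContinuousLinearMap.adjoint J)) u = J w := by
  set Q : H →L[ℂ] H := CFC.sqrt (J.comp (ContinuousLinearMap.adjoint J)) with hQ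
  have hinj : Function.Injective (Q : H →ₗ[ℂ] H) :=
    (injective_iff_map_eq_zero (Q : H →ₗ[ℂ] H)).2 fun x hx => hJ x <| by
      rw [← norm_eq_zero, ← norm_sqrt_comp_adjoint_apply]
      exact norm_eq_zero.2 hx
  let e := LinearEquiv.ofInjective (Q : H →ₗ[ℂ] H) hinj
  -- Since `‖Q x‖ = ‖J* x‖`, the functional `Q x ↦ ⟨w, J* x⟩` on the range of `Q` is well defined
  -- and bounded by `‖w‖`. Extending it and representing it by a vector `u` gives `⟨u, Q x⟩ = ⟨J w,
  -- x⟩`, that is `Q u = J w`.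
  let l : LinearMap.range (Q : H →ₗ[ℂ] H) →ₗ[ℂ] ℂ :=
    (innerSL ℂ w : E →ₗ[ℂ] ℂ).comp
      ((ContinuousLinearMap.adjoint J : H →ₗ[ℂ] E).comp
        (e.symm : LinearMap.range (Q : H →ₗ[ℂ] H) →ₗ[ℂ] H))
  have hle : ∀ x, l (e x) = ⟪w, ContinuousLinearMap.adjoint J x⟫_ℂ := fun x => by
    simp [l]
  have hl : ∀ y, ‖l y‖ ≤ ‖w‖ * ‖y‖ := by
    intro y
    obtain ⟨x, rfl⟩ := e.surjective y
    have h2 : ‖e x‖ = ‖ContinuousLinearMap.adjoint J x‖ := norm_sqrt_comp_adjoint_apply J x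
    rw [hle, h2]
    exact norm_inner_le_norm _ _
  obtain ⟨g, hg, -⟩ := exists_extension_norm_eq _ (l.mkContinuous _ hl)
  refine ⟨(InnerProductSpace.toDual ℂ H).symm g, ?_⟩
  refine ext_inner_right ℂ fun x => ?_
  have h3 : g (Q x) = l (e x) := hg (e x)
  rw [inner_sqrt_apply, InnerProductSpace.toDual_symm_apply, ← hQ, h3, hle,
    ContinuousLinearMap.adjoint_inner_right]

theorem denseRange_sqrt {R : H →L[ℂ] H} (hR : ∀ x, CFC.sqrt R x = 0 → x = 0) :
    DenseRange (CFC.sqrt R : H →L[ℂ] H) := by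
  have h : (LinearMap.range ((CFC.sqrt R : H →L[ℂ] H) : H →ₗ[ℂ] H)).topologicalClosure = ⊤ := by
    rw [Submodule.topologicalClosure_eq_top_iff, Submodule.eq_bot_iff]
    intro x hx
    refine hR x ?_
    have h1 := (Submodule.mem_orthogonal _ x).1 hx (CFC.sqrt R (CFC.sqrt R x)) ⟨CFC.sqrt R x, rfl⟩
    rw [inner_sqrt_apply] at h1
    exact inner_self_eq_zero.1 h1
  exact Submodule.dense_iff_topologicalClosure_eq_top.2 h

end CompAdjoint

/-! ### The closed graph and the modulus -/

section Graph

variable {H K : Type*} [NormedAddCommGroup H] [InnerProductSpace ℂ H] [CompleteSpace H]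
  [NormedAddCommGroup K] [InnerProductSpace ℂ K] [CompleteSpace K]

/-- The operator with graph `G` is densely defined. -/
def IsDenselyDefinedGraph (G : Submodule ℂ (WithLp 2 (H × K))) : Prop :=
  ∀ f : H, (∀ z ∈ G, inner ℂ z.fst f = 0) → f = 0

variable (G : Submodule ℂ (WithLp 2 (H × K)))

theorem graphResolvent_nonneg : 0 ≤ graphResolvent G :=
  (ContinuousLinearMap.nonneg_iff_isPositive _).2
    (ContinuousLinearMap.isPositive_self_comp_adjoint (graphProjection G))

omit [CompleteSpace H] [CompleteSpace K] in
theorem norm_graphProjection_le : ‖graphProjection G‖ ≤ 1 :=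
  ContinuousLinearMap.opNorm_le_bound _ zero_le_one fun z => by
    rw [one_mul]
    change ‖(z : WithLp 2 (H × K)).fst‖ ≤ ‖(z : WithLp 2 (H × K))‖
    rw [WithLp.prod_norm_eq_of_L2]
    exact Real.le_sqrt_of_sq_le (le_add_of_nonneg_right (sq_nonneg _))

theorem graphResolvent_le_one : graphResolvent G ≤ 1 :=
  comp_adjoint_le_one (graphProjection G) (norm_graphProjection_le G)

variable {G}

theorem adjoint_graphProjection_injective (hG : IsDenselyDefinedGraph G) (x : H)
    (hx : ContinuousLinearMap.adjoint (graphProjection G) x = 0) : x = 0 := by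
  refine hG x fun z hz => ?_
  have h := ContinuousLinearMap.adjoint_inner_right (graphProjection G)
    ⟨z, G.le_topologicalClosure hz⟩ x
  rw [hx, inner_zero_right] at h
  exact h.symm

theorem denseRange_sqrt_graphResolvent (hG : IsDenselyDefinedGraph G) :
    DenseRange (CFC.sqrt (graphResolvent G) : H →L[ℂ] H) :=
  denseRange_sqrt fun x hx => adjoint_graphProjection_injective hG x <| by
    rw [← norm_eq_zero, ← norm_sqrt_comp_adjoint_apply]
    exact norm_eq_zero.2 hx

/-- With `u = exp (-t |D|) y`, the pair `p` is `(u, D u)`, obtained as `J* f` for `f = u + |D|² u`.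
The defining property of the resolvent, after cancelling `⟨z.fst, u⟩`, is the weak form of `D* D u =
|D|² u`. -/
theorem exists_mem_closure_fst_eq_heatOperator (y : H) {t : ℝ} (ht : 0 < t) :
    ∃ p ∈ G.topologicalClosure, p.fst = heatOperator (graphResolvent G) 0 t y ∧
      ∀ z ∈ G.topologicalClosure,
        ⟪z.fst, heatOperator (graphResolvent G) 2 t y⟫_ℂ = ⟪z.snd, p.snd⟫_ℂ := by
  set f := (heatOperator (graphResolvent G) 0 t + heatOperator (graphResolvent G) 2 t) y with hf
  obtain ⟨p, hp, hpf⟩ : ∃ p : G.topologicalClosure, (p : WithLp 2 (H × K)).fst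
      = graphResolvent G f ∧ ∀ z (hz : z ∈ G.topologicalClosure),
        ⟪z, (p : WithLp 2 (H × K))⟫_ℂ = ⟪z.fst, f⟫_ℂ :=
    ⟨ContinuousLinearMap.adjoint (graphProjection G) f, rfl, fun z hz =>
      ContinuousLinearMap.adjoint_inner_right (graphProjection G) ⟨z, hz⟩ f⟩
  have hR : graphResolvent G f = heatOperator (graphResolvent G) 0 t y :=
    congrArg (fun B : H →L[ℂ] H => B y) (comp_heatOperator_zero_add_two (graphResolvent_nonneg G)
      (graphResolvent_le_one G) ht)
  rw [hR] at hp
  refine ⟨p, p.2, hp, fun z hz => ?_⟩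
  have h := hpf z hz
  rw [WithLp.prod_inner_apply] at h
  change ⟪z.fst, (p : WithLp 2 (H × K)).fst⟫_ℂ + ⟪z.snd, (p : WithLp 2 (H × K)).snd⟫_ℂ = _ at h
  rw [hp, hf, _root_.add_apply, inner_add_right, add_right_inj] at h
  exact h.symm

theorem mem_modulusGraph_iff {z : H × H} : z ∈ modulusGraph G ↔
    ∃ a, CFC.sqrt (graphResolvent G) a = z.1 ∧ CFC.sqrt (1 - graphResolvent G) a = z.2 := by
  constructor
  · rintro ⟨a, rfl⟩
    exact ⟨a, rfl, rfl⟩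
  · rintro ⟨a, h1, h2⟩
    exact ⟨a, Prod.ext h1 h2⟩

/-- The domain of `D` is contained in the domain of `|D|`. -/
theorem exists_mem_modulusGraph (hG : IsDenselyDefinedGraph G)
    {z : WithLp 2 (H × K)} (hz : z ∈ G.topologicalClosure) : ∃ y, (z.fst, y) ∈ modulusGraph G := by
  obtain ⟨u, hu⟩ := exists_sqrt_comp_adjoint_apply_eq (graphProjection G)
    (adjoint_graphProjection_injective hG) ⟨z, hz⟩
  exact ⟨_, mem_modulusGraph_iff.2 ⟨u, hu, rfl⟩⟩

theorem commute_sqrt_sqrt_one_sub :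
    CFC.sqrt (graphResolvent G) * CFC.sqrt (1 - graphResolvent G)
      = CFC.sqrt (1 - graphResolvent G) * CFC.sqrt (graphResolvent G) := by
  have h0 := graphResolvent_nonneg G
  rw [sqrt_eq_cfc h0, sqrt_one_sub_eq_cfc h0 (graphResolvent_le_one G)]
  exact cfc_commute_cfc _ _ _

/-- The modulus `|D|` is a symmetric operator. -/
theorem inner_modulusGraph {z w : H × H} (hz : z ∈ modulusGraph G) (hw : w ∈ modulusGraph G) :
    ⟪z.1, w.2⟫_ℂ = ⟪z.2, w.1⟫_ℂ := by
  obtain ⟨a, ha1, ha2⟩ := mem_modulusGraph_iff.1 hz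
  obtain ⟨b, hb1, hb2⟩ := mem_modulusGraph_iff.1 hw
  rw [← ha1, ← ha2, ← hb1, ← hb2, inner_sqrt_apply, inner_sqrt_apply]
  exact congrArg (fun B : H →L[ℂ] H => ⟪a, B b⟫_ℂ) commute_sqrt_sqrt_one_sub

end Graph

/-- A convex function that is bounded above on a half-line does not increase. -/
theorem hasDerivAt_nonpos_of_bounded {N N₁ N₂ : ℝ → ℝ} {b C : ℝ}
    (h₀ : ∀ t, b < t → HasDerivAt N (N₁ t) t) (h₁ : ∀ t, b < t → HasDerivAt N₁ (N₂ t) t)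
    (h₂ : ∀ t, b < t → 0 ≤ N₂ t) (hC : ∀ t, b < t → N t ≤ C) {t : ℝ} (ht : b < t) :
    N₁ t ≤ 0 := by
  by_contra! hpos
  have hmono : MonotoneOn N₁ (Set.Ioi b) :=
    monotoneOn_of_deriv_nonneg (convex_Ioi b)
      (fun u hu => (h₁ u hu).continuousAt.continuousWithinAt)
      (fun u hu => (h₁ u (interior_subset hu)).differentiableAt.differentiableWithinAt)
      (fun u hu => by
        rw [(h₁ u (interior_subset hu)).deriv]
        exact h₂ u (interior_subset hu))
  have hd : ∀ u, b < u → HasDerivAt (fun u => N u - u * N₁ t) (N₁ u - 1 * N₁ t) u := fun u hu =>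
    (h₀ u hu).sub ((hasDerivAt_id u).mul_const (N₁ t))
  have hsub : ∀ u ∈ Set.Ici t, b < u := fun u hu => ht.trans_le hu
  have hgrow : MonotoneOn (fun u => N u - u * N₁ t) (Set.Ici t) :=
    monotoneOn_of_deriv_nonneg (convex_Ici t)
      (fun u hu => (hd u (hsub u hu)).continuousAt.continuousWithinAt)
      (fun u hu => (hd u (hsub u (interior_subset hu))).differentiableAt.differentiableWithinAt)
      (fun u hu => by
        have hu' := interior_subset hu
        rw [(hd u (hsub u hu')).deriv, one_mul]
        exact sub_nonneg.2 (hmono ht (hsub u hu') hu'))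
  have hC0 : 0 ≤ C - N t := sub_nonneg.2 (hC t ht)
  -- At this time the tangent line at `t`, which lies below `N`, has reached the height `C + 1`,
  -- contradicting the bound.
  have hle : t ≤ t + (C - N t + 1) / N₁ t := by
    have : 0 ≤ (C - N t + 1) / N₁ t := by positivity
    linarith
  have h := hgrow Set.self_mem_Ici (show _ ∈ Set.Ici t from hle) hle
  have h3 := hC _ (ht.trans_le hle)
  have h4 : (C - N t + 1) / N₁ t * N₁ t = C - N t + 1 := div_mul_cancel₀ _ hpos.ne'
  simp only at h
  nlinarith

/-! ### Convexity along the semigroup implies positivity -/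

section WeightedPositivity

variable {H K : Type*} [NormedAddCommGroup H] [InnerProductSpace ℂ H] [CompleteSpace H]
  [NormedAddCommGroup K] [InnerProductSpace ℂ K] [CompleteSpace K]

/-- `F'` is the derivative of the operator-valued function `F` on `(0, ∞)`, with a quadratic bound
for the remainder that is locally uniform. -/
def HasQuadraticRemainder (F F' : ℝ → H →L[ℂ] H) : Prop :=
  ∀ a, 0 < a → ∃ C, ∀ s t, a < s → a < t →
    ‖F s - F t - ((s - t : ℝ) : ℂ) • F' t‖ ≤ C * (s - t) ^ 2

omit [CompleteSpace H] in
theorem HasQuadraticRemainder.hasDerivAt {F F' : ℝ → H →L[ℂ] H} (h : HasQuadraticRemainder F F')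
    {t : ℝ} (ht : 0 < t) : HasDerivAt F (F' t) t := by
  obtain ⟨C, hC⟩ := h (t / 2) (by positivity)
  refine hasDerivAt_of_norm_sub_le_sq (a := t / 2) (C := C) (by linarith) fun s hs => ?_
  rw [← Complex.coe_smul]
  exact hC s t hs (by linarith)

theorem hasDerivAt_heatOperator_apply {R : H →L[ℂ] H} (hR : 0 ≤ R) (i : ℕ) (x : H) {c t : ℝ}
    (ht : 0 < t + c) : HasDerivAt (fun t => heatOperator R i (t + c) x)
      (-heatOperator R (i + 1) (t + c) x) t := by
  have h : HasDerivAt (fun t => heatOperator R i (t + c)) (-heatOperator R (i + 1) (t + c)) t :=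
    (hasDerivAt_heatOperator hR i ht).comp_add_const t c
  have h2 := ((ContinuousLinearMap.apply ℂ H x).restrictScalars ℝ).hasFDerivAt.comp_hasDerivAt t h
  exact h2

omit [CompleteSpace H] in
theorem hasDerivAt_clm_apply_complex {F : ℝ → H →L[ℂ] H} {F' : H →L[ℂ] H} {u : ℝ → H} {u' : H}
    {t : ℝ} (hF : HasDerivAt F F' t) (hu : HasDerivAt u u' t) :
    HasDerivAt (fun t => F t (u t)) (F' (u t) + F t u') t := by
  let l : (H →L[ℂ] H) →L[ℝ] H →L[ℝ] H := ContinuousLinearMap.restrictScalarsL ℂ H H ℝ ℝ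
  exact (l.hasFDerivAt.comp_hasDerivAt t hF).clm_apply hu

variable {G : Submodule ℂ (WithLp 2 (H × K))}

/-- Positivity of `W |D| + |D| W` for the trace `W = W t` of a family of weights for which
`⟨W u, u⟩` is convex along the semigroup `u = exp (-t |D|) ψ`. -/
theorem re_inner_weight_modulus_nonneg (hG : IsDenselyDefinedGraph G)
    {W W₁ W₂ : ℝ → H →L[ℂ] H} {C : ℝ} (hW : HasQuadraticRemainder W W₁)
    (hW₁ : HasQuadraticRemainder W₁ W₂) (hC : ∀ t, 0 < t → ‖W t‖ ≤ C)
    (hsymm : ∀ t x y, ⟪W t x, y⟫_ℂ = ⟪x, W t y⟫_ℂ)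
    (hsymm₁ : ∀ t x y, ⟪W₁ t x, y⟫_ℂ = ⟪x, W₁ t y⟫_ℂ)
    (hpos : ∀ t x, 0 < t → 0 ≤ (⟪W₁ t x, x⟫_ℂ).re)
    (hconv : ∀ t, 0 < t → ∀ p ∈ G.topologicalClosure, ∀ y f : H,
      (∀ z ∈ G.topologicalClosure, ⟪z.fst, f⟫_ℂ = ⟪z.snd, p.snd⟫_ℂ) →
      0 ≤ (⟪W₂ t p.fst, p.fst⟫_ℂ).re - 4 * (⟪W₁ t p.fst, y⟫_ℂ).re + 2 * (⟪W t y, y⟫_ℂ).re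
        + 2 * (⟪W t p.fst, f⟫_ℂ).re)
    {t : ℝ} (ht : 0 < t) {z : H × H} (hz : z ∈ modulusGraph G) : 0 ≤ (⟪W t z.1, z.2⟫_ℂ).re := by
  obtain ⟨a, ha1, ha2⟩ := mem_modulusGraph_iff.1 hz
  rw [← ha1, ← ha2]
  set R := graphResolvent G with hRdef
  have hR0 : 0 ≤ R := graphResolvent_nonneg G
  have hR1 : R ≤ 1 := graphResolvent_le_one G
  set x := CFC.sqrt R a with hx
  have hC0 : 0 ≤ C := (norm_nonneg _).trans (hC t ht)
  -- The weight runs at time `r` and the semigroup at time `r + c`; at `r = t` these are `t` and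
  -- `s`. Beyond `max 0 (-c)` both times are positive, so everything is differentiable in norm.
  have key : ∀ s, 0 < s → 0 ≤ (⟪W t (heatOperator R 0 s x), heatOperator R 1 s x⟫_ℂ).re := by
    intro s hs
    set c := s - t with hc
    set U : ℕ → ℝ → H := fun i r => heatOperator R i (r + c) x with hU
    have hb : ∀ r, max 0 (-c) < r → 0 < r ∧ 0 < r + c := fun r hr =>
      ⟨(le_max_left _ _).trans_lt hr, by linarith [(le_max_right 0 (-c)).trans_lt hr]⟩
    have hUd : ∀ i r, max 0 (-c) < r → HasDerivAt (U i) (-U (i + 1) r) r := fun i r hr =>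
      hasDerivAt_heatOperator_apply hR0 i x (hb r hr).2
    have hre : ∀ {f : ℝ → ℂ} {f' : ℂ} {r : ℝ}, HasDerivAt f f' r →
        HasDerivAt (fun r => (f r).re) f'.re r := fun h =>
      Complex.reCLM.hasFDerivAt.comp_hasDerivAt _ h
    have hconj : ∀ y z : H, (⟪y, z⟫_ℂ).re = (⟪z, y⟫_ℂ).re := fun y z => by
      rw [← inner_conj_symm, Complex.conj_re]
    have h0 : ∀ r, max 0 (-c) < r → HasDerivAt (fun r => (⟪W r (U 0 r), U 0 r⟫_ℂ).re)
        ((⟪W₁ r (U 0 r), U 0 r⟫_ℂ).re - 2 * (⟪W r (U 0 r), U 1 r⟫_ℂ).re) r := by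
      intro r hr
      have h := hre (HasDerivAt.inner ℂ (hasDerivAt_clm_apply_complex (hW.hasDerivAt (hb r hr).1)
        (hUd 0 r hr)) (hUd 0 r hr))
      convert! h using 1
      have e : (⟪W r (U 1 r), U 0 r⟫_ℂ).re = (⟪W r (U 0 r), U 1 r⟫_ℂ).re := by
        rw [hsymm, hconj]
      simp only [inner_neg_right, inner_add_left, map_neg, inner_neg_left, Complex.add_re,
        Complex.neg_re, zero_add, e]
      ring
    have h1 : ∀ r, max 0 (-c) < r → HasDerivAt
        (fun r => (⟪W₁ r (U 0 r), U 0 r⟫_ℂ).re - 2 * (⟪W r (U 0 r), U 1 r⟫_ℂ).re)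
        ((⟪W₂ r (U 0 r), U 0 r⟫_ℂ).re - 4 * (⟪W₁ r (U 0 r), U 1 r⟫_ℂ).re
          + 2 * (⟪W r (U 1 r), U 1 r⟫_ℂ).re + 2 * (⟪W r (U 0 r), U 2 r⟫_ℂ).re) r := by
      intro r hr
      have ha := hre (HasDerivAt.inner ℂ (hasDerivAt_clm_apply_complex (hW₁.hasDerivAt (hb r hr).1)
        (hUd 0 r hr)) (hUd 0 r hr))
      have hb := hre (HasDerivAt.inner ℂ (hasDerivAt_clm_apply_complex (hW.hasDerivAt (hb r hr).1)
        (hUd 0 r hr)) (hUd 1 r hr))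
      convert! ha.sub (hb.const_mul 2) using 1
      have e : (⟪W₁ r (U 1 r), U 0 r⟫_ℂ).re = (⟪W₁ r (U 0 r), U 1 r⟫_ℂ).re := by
        rw [hsymm₁, hconj]
      simp only [inner_neg_right, inner_add_left, map_neg, inner_neg_left, Complex.add_re,
        Complex.neg_re, zero_add, one_add_one_eq_two, e]
      ring
    have h2 : ∀ r, max 0 (-c) < r → 0 ≤ (⟪W₂ r (U 0 r), U 0 r⟫_ℂ).re
        - 4 * (⟪W₁ r (U 0 r), U 1 r⟫_ℂ).re
          + 2 * (⟪W r (U 1 r), U 1 r⟫_ℂ).re + 2 * (⟪W r (U 0 r), U 2 r⟫_ℂ).re := by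
      intro r hr
      obtain ⟨p, hp, hp1, hp2⟩ := exists_mem_closure_fst_eq_heatOperator (G := G) x (hb r hr).2
      have h := hconv r (hb r hr).1 p hp (U 1 r) (U 2 r) hp2
      rwa [hp1] at h
    have hbd : ∀ r, max 0 (-c) < r → (⟪W r (U 0 r), U 0 r⟫_ℂ).re ≤ C * ‖x‖ * ‖x‖ := by
      intro r hr
      have e1 : ‖U 0 r‖ ≤ ‖x‖ :=
        (ContinuousLinearMap.le_of_opNorm_le _ (norm_heatOperator_zero_le (hb r hr).2) x).trans_eq
          (one_mul _)
      calc (⟪W r (U 0 r), U 0 r⟫_ℂ).re ≤ ‖⟪W r (U 0 r), U 0 r⟫_ℂ‖ := Complex.re_le_norm _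
        _ ≤ ‖W r (U 0 r)‖ * ‖U 0 r‖ := norm_inner_le_norm _ _
        _ ≤ (C * ‖U 0 r‖) * ‖U 0 r‖ := by
            gcongr
            exact ContinuousLinearMap.le_of_opNorm_le _ (hC r (hb r hr).1) _
        _ ≤ C * ‖x‖ * ‖x‖ := by gcongr
    have hlt : max 0 (-c) < t := max_lt ht (by rw [hc]; linarith)
    -- The nonpositive first derivative reads `⟨W₁ u, u⟩ ≤ 2 Re ⟨W u, |D| u⟩`, and the left side is
    -- nonnegative by `hpos`.
    have h := hasDerivAt_nonpos_of_bounded h0 h1 h2 hbd hlt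
    have hp := hpos t (U 0 t) ht
    have e : t + c = s := by rw [hc]; ring
    simp only [hU, e] at h hp
    linarith
  -- Now `s → 0` with the weight fixed. The factor `|D| exp (-s |D|) x` converges because it equals
  -- `exp (-s |D|)` applied to `(1 - R)^{1/2} a`.
  have hlim0 := tendsto_heatOperator_zero hR0 hR1 (denseRange_sqrt_graphResolvent hG) x
  have hlim1 := tendsto_heatOperator_zero hR0 hR1 (denseRange_sqrt_graphResolvent hG)
    (CFC.sqrt (1 - R) a)
  have hlim := Complex.continuous_re.continuousAt.tendsto.comp
    ((((W t).continuous.tendsto x).comp hlim0).inner (𝕜 := ℂ) hlim1)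
  refine ge_of_tendsto hlim ?_
  filter_upwards [self_mem_nhdsWithin] with s hs
  have h := key s hs
  have e : heatOperator R 1 s x = heatOperator R 0 s (CFC.sqrt (1 - R) a) :=
    congrArg (fun B : H →L[ℂ] H => B a) (heatOperator_one_mul_sqrt hR0 hR1 hs)
  rw [e] at h
  exact h

end WeightedPositivity

/-! ### Multiplication operators on `L²` -/

section Multiplication

variable {X E : Type*} [MeasurableSpace X] {μ : Measure X} [NormedAddCommGroup E] [NormedSpace ℂ E]

/-- Multiplication by a bounded function `m` on `L²`. -/
def mulLp {m : X → ℂ} (hm : MemLp m ⊤ μ) : Lp E 2 μ →L[ℂ] Lp E 2 μ :=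
  (ContinuousLinearMap.lsmul ℂ ℂ : ℂ →L[ℂ] E →L[ℂ] E).holderL μ ⊤ 2 2 hm.toLp

theorem coeFn_mulLp {m : X → ℂ} (hm : MemLp m ⊤ μ) (u : Lp E 2 μ) :
    (mulLp hm u : X → E) =ᵐ[μ] fun x => m x • u x := by
  refine (ContinuousLinearMap.coeFn_holder (r := 2) _ hm.toLp u).trans ?_
  filter_upwards [hm.coeFn_toLp] with x hx
  rw [hx]
  rfl

/-- Multiplication of scalar functions in `L²` by a bounded vector field `V`. -/
def mulFieldLp {V : X → E} (hV : MemLp V ⊤ μ) : Lp ℂ 2 μ →L[ℂ] Lp E 2 μ :=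
  (ContinuousLinearMap.lsmul ℂ ℂ : ℂ →L[ℂ] E →L[ℂ] E).flip.holderL μ ⊤ 2 2 hV.toLp

theorem coeFn_mulFieldLp {V : X → E} (hV : MemLp V ⊤ μ) (u : Lp ℂ 2 μ) :
    (mulFieldLp hV u : X → E) =ᵐ[μ] fun x => u x • V x := by
  refine (ContinuousLinearMap.coeFn_holder (r := 2) _ hV.toLp u).trans ?_
  filter_upwards [hV.coeFn_toLp] with x hx
  rw [hx]
  rfl

omit [NormedSpace ℂ E] in
theorem norm_le_of_ae_norm_le {u v : Lp E 2 μ} {C : ℝ} (hC : 0 ≤ C)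
    (h : ∀ᵐ x ∂μ, ‖u x‖ ≤ C * ‖v x‖) : ‖u‖ ≤ C * ‖v‖ := by
  have h1 := eLpNorm_le_mul_eLpNorm_of_ae_le_mul h 2
  rw [Lp.norm_def, Lp.norm_def, ← ENNReal.toReal_ofReal hC, ← ENNReal.toReal_mul]
  exact ENNReal.toReal_mono (ENNReal.mul_ne_top ENNReal.ofReal_ne_top (Lp.eLpNorm_ne_top v)) h1

theorem norm_clm_le_of_coeFn {B : Lp E 2 μ →L[ℂ] Lp E 2 μ} {m : X → ℂ} {C : ℝ} (hC : 0 ≤ C)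
    (hB : ∀ u, (B u : X → E) =ᵐ[μ] fun x => m x • u x) (h : ∀ x, ‖m x‖ ≤ C) : ‖B‖ ≤ C := by
  refine ContinuousLinearMap.opNorm_le_bound _ hC fun u => norm_le_of_ae_norm_le hC ?_
  filter_upwards [hB u] with x hx
  rw [hx, norm_smul]
  gcongr
  exact h x

end Multiplication

section MultiplicationInner

variable {X E : Type*} [MeasurableSpace X] {μ : Measure X} [NormedAddCommGroup E]
  [InnerProductSpace ℂ E]

theorem re_inner_eq_integral (u v : Lp E 2 μ) :
    (⟪u, v⟫_ℂ).re = ∫ x, (⟪u x, v x⟫_ℂ).re ∂μ := by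
  rw [L2.inner_def]
  exact (integral_re (𝕜 := ℂ) (L2.integrable_inner (𝕜 := ℂ) u v)).symm

theorem integrable_re_inner (u v : Lp E 2 μ) : Integrable (fun x => (⟪u x, v x⟫_ℂ).re) μ :=
  (L2.integrable_inner (𝕜 := ℂ) u v).re

theorem inner_mulLp_ofReal {m : X → ℝ} (hm : MemLp (fun x => (m x : ℂ)) ⊤ μ) (u v : Lp E 2 μ) :
    ⟪mulLp hm u, v⟫_ℂ = ⟪u, mulLp hm v⟫_ℂ := by
  rw [L2.inner_def, L2.inner_def]
  refine integral_congr_ae ?_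
  filter_upwards [coeFn_mulLp hm u, coeFn_mulLp hm v] with x h1 h2
  rw [h1, h2, inner_smul_left, inner_smul_right, Complex.conj_ofReal]

theorem re_inner_mulLp_nonneg {m : X → ℝ} (hm : MemLp (fun x => (m x : ℂ)) ⊤ μ)
    (h0 : ∀ x, 0 ≤ m x) (u : Lp E 2 μ) : 0 ≤ (⟪mulLp hm u, u⟫_ℂ).re := by
  rw [re_inner_eq_integral]
  refine integral_nonneg_of_ae ?_
  filter_upwards [coeFn_mulLp hm u] with x hx
  rw [hx, inner_smul_left, Complex.conj_ofReal, Complex.re_ofReal_mul]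
  exact mul_nonneg (h0 x) (inner_self_nonneg (𝕜 := ℂ))

end MultiplicationInner

/-! ### Product rule and integration by parts for the magnetic momentum -/

section Graph

/-- `-i ∇m` for the gradient `g = ∇m`, as a field of complex vectors. -/
def momentumField (g : Plane → Plane) (x : Plane) : EuclideanSpace ℂ (Fin 2) :=
  WithLp.toLp 2 fun j => -Complex.I * (g x j : ℂ)

theorem norm_momentumField (g : Plane → Plane) (x : Plane) : ‖momentumField g x‖ = ‖g x‖ := by
  simp [momentumField, EuclideanSpace.norm_eq]

theorem memLp_top_ofReal {m : Plane → ℝ} (hm : Continuous m) {C : ℝ} (hC : ∀ x, |m x| ≤ C) :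
    MemLp (fun x => (m x : ℂ)) ⊤ (volume : Measure Plane) :=
  memLp_top_of_bound (Complex.continuous_ofReal.comp hm).aestronglyMeasurable C
    (Filter.Eventually.of_forall fun x => by simpa using hC x)

theorem memLp_top_momentumField {g : Plane → Plane} (hg : Continuous g) {C : ℝ}
    (hC : ∀ x, ‖g x‖ ≤ C) : MemLp (momentumField g) ⊤ (volume : Measure Plane) :=
  memLp_top_of_bound (by
      refine Continuous.aestronglyMeasurable ?_
      unfold momentumField
      fun_prop) C
    (Filter.Eventually.of_forall fun x => by simpa [norm_momentumField] using hC x)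

theorem IsTestFunction.ofReal_mul {m : Plane → ℝ} (hm : ContDiff ℝ ∞ m) {φ : Plane → ℂ}
    (hφ : IsTestFunction φ) : IsTestFunction fun x => (m x : ℂ) * φ x :=
  ⟨(Complex.ofRealCLM.contDiff.comp hm).mul hφ.1, hφ.2.mul_left⟩

theorem magneticMomentum_ofReal_mul (A : Plane → Plane) {m : Plane → ℝ} {g : Plane → Plane}
    (hm : ContDiff ℝ ∞ m) (hg : ∀ x j, fderiv ℝ m x (EuclideanSpace.single j 1) = g x j)
    {φ : Plane → ℂ} (hφ : IsTestFunction φ) (x : Plane) :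
    magneticMomentum A (fun x => (m x : ℂ) * φ x) x
      = (m x : ℂ) • magneticMomentum A φ x + φ x • momentumField g x := by
  have h1 : HasFDerivAt (fun x => (m x : ℂ)) (Complex.ofRealCLM.comp (fderiv ℝ m x)) x :=
    Complex.ofRealCLM.hasFDerivAt.comp x (hm.differentiable (by simp) x).hasFDerivAt
  have h2 := (h1.mul (hφ.differentiable x).hasFDerivAt).fderiv
  ext j
  simp only [magneticMomentum, momentumField, PiLp.add_apply, PiLp.smul_apply, smul_eq_mul]
  rw [show (fun x => (m x : ℂ) * φ x) = (fun y => (m y : ℂ)) * φ from rfl, h2]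
  simp only [_root_.add_apply, _root_.smul_apply, ContinuousLinearMap.comp_apply, hg, smul_eq_mul,
    Complex.ofRealCLM_apply]
  ring

/-- The domain of the closure of `p + A` is invariant under multiplication by a bounded smooth
function with bounded gradient. -/
theorem mul_mem_closure_magneticMomentumGraph {A : Plane → Plane} {m : Plane → ℝ}
    {g : Plane → Plane} (hm : ContDiff ℝ ∞ m)
    (hg : ∀ x j, fderiv ℝ m x (EuclideanSpace.single j 1) = g x j)
    (hmb : MemLp (fun x => (m x : ℂ)) ⊤ (volume : Measure Plane))
    (hgb : MemLp (momentumField g) ⊤ (volume : Measure Plane))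
    {p : WithLp 2 (L2Scalar × L2Vector)} (hp : p ∈ (magneticMomentumGraph A).topologicalClosure) :
    WithLp.toLp 2 (mulLp hmb p.fst, mulLp hmb p.snd + mulFieldLp hgb p.fst)
      ∈ (magneticMomentumGraph A).topologicalClosure := by
  refine map_mem_closure (f := fun p : WithLp 2 (L2Scalar × L2Vector) =>
    (WithLp.toLp 2 (mulLp hmb p.fst, mulLp hmb p.snd + mulFieldLp hgb p.fst) :
      WithLp 2 (L2Scalar × L2Vector))) ?_ hp ?_
  · have c1 : Continuous fun p : WithLp 2 (L2Scalar × L2Vector) => p.fst :=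
      WithLp.continuous_fst 2 _ _
    have c2 : Continuous fun p : WithLp 2 (L2Scalar × L2Vector) => p.snd :=
      WithLp.continuous_snd 2 _ _
    exact (WithLp.prod_continuous_toLp 2 _ _).comp (((mulLp hmb).continuous.comp c1).prodMk
      (((mulLp hmb).continuous.comp c2).add ((mulFieldLp hgb).continuous.comp c1)))
  · rintro z ⟨φ, hφ, h1, h2⟩
    refine ⟨_, hφ.ofReal_mul hm, ?_, ?_⟩
    · filter_upwards [coeFn_mulLp hmb z.fst, h1] with x e1 e2
      change (mulLp hmb z.fst : Plane → ℂ) x = _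
      rw [e1, e2, smul_eq_mul]
    · filter_upwards [coeFn_mulLp hmb z.snd, coeFn_mulFieldLp hgb z.fst, h1, h2,
        Lp.coeFn_add (mulLp hmb z.snd) (mulFieldLp hgb z.fst)] with x e1 e2 e3 e4 e5
      change (mulLp hmb z.snd + mulFieldLp hgb z.fst : L2Vector) x = _
      rw [e5, Pi.add_apply, e1, e2, e3, e4, magneticMomentum_ofReal_mul A hm hg hφ]

/-- The potential drops out: `A` is real and `-i g` is imaginary, so their contribution `i g · A
|φ|²` has no real part. What remains is `2 g · Re (conj φ ∇φ) = g · ∇|φ|²`. -/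
theorem two_mul_re_inner_momentumField (A : Plane → Plane) (g : Plane → Plane) {φ : Plane → ℂ}
    (hφ : IsTestFunction φ) (x : Plane) :
    2 * (⟪φ x • momentumField g x, magneticMomentum A φ x⟫_ℂ).re
      = ∑ j, g x j * fderiv ℝ (fun y => Complex.normSq (φ y)) x (EuclideanSpace.single j 1) := by
  have hd := (hφ.differentiable x).hasFDerivAt
  have hre : HasFDerivAt (fun y => (φ y).re) (Complex.reCLM.comp (fderiv ℝ φ x)) x :=
    Complex.reCLM.hasFDerivAt.comp x hd
  have him : HasFDerivAt (fun y => (φ y).im) (Complex.imCLM.comp (fderiv ℝ φ x)) x :=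
    Complex.imCLM.hasFDerivAt.comp x hd
  have h := ((hre.mul hre).add (him.mul him)).fderiv
  rw [show (fun y => Complex.normSq (φ y))
    = (fun y => (φ y).re) * (fun y => (φ y).re) + (fun y => (φ y).im) * (fun y => (φ y).im) from
      funext fun y => Complex.normSq_apply _, h, PiLp.inner_apply, Complex.re_sum, Finset.mul_sum]
  refine Finset.sum_congr rfl fun j _ => ?_
  simp only [magneticMomentum, momentumField, PiLp.smul_apply, smul_eq_mul, RCLike.inner_apply,
    _root_.add_apply, _root_.smul_apply, ContinuousLinearMap.comp_apply, Complex.reCLM_apply,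
    Complex.imCLM_apply]
  simp only [map_mul, map_neg, Complex.conj_I, Complex.conj_ofReal, Complex.mul_re, Complex.mul_im,
    Complex.add_re, Complex.add_im, Complex.neg_re, Complex.neg_im, Complex.I_re, Complex.I_im,
    Complex.ofReal_re, Complex.ofReal_im, Complex.conj_re, Complex.conj_im]
  ring

theorem integral_gradient_mul_normSq {g : Plane → Plane} {l : Plane → ℝ}
    (hg : ContDiff ℝ ∞ g)
    (hl : ∀ x, ∑ j, fderiv ℝ (fun y => g y j) x (EuclideanSpace.single j 1) = l x)
    {φ : Plane → ℂ} (hφ : IsTestFunction φ) :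
    ∫ x, ∑ j, g x j * fderiv ℝ (fun y => Complex.normSq (φ y)) x (EuclideanSpace.single j 1)
      = -∫ x, l x * Complex.normSq (φ x) := by
  set ρ : Plane → ℝ := fun y => Complex.normSq (φ y) with hρ
  have hρd : ContDiff ℝ ∞ ρ := by
    have h1 : ContDiff ℝ ∞ fun y => (φ y).re := Complex.reCLM.contDiff.comp hφ.1
    have h2 : ContDiff ℝ ∞ fun y => (φ y).im := Complex.imCLM.contDiff.comp hφ.1
    simpa only [hρ, Complex.normSq_apply] using (h1.mul h1).add (h2.mul h2)
  have hρc : HasCompactSupport ρ := hφ.2.comp_left (g := Complex.normSq) (by simp)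
  have hgj : ∀ j, ContDiff ℝ ∞ fun y => g y j := fun j =>
    contDiff_euclidean.1 hg j
  have hcd : ∀ (f : Plane → ℝ) (v : Plane), ContDiff ℝ ∞ f →
      Continuous fun x => fderiv ℝ f x v := fun f v hf =>
    (hf.continuous_fderiv (by simp)).clm_apply continuous_const
  have hint1 : ∀ j, Integrable
      (fun x => g x j * fderiv ℝ ρ x (EuclideanSpace.single j 1)) volume := fun j =>
    ((hgj j).continuous.mul (hcd _ _ hρd)).integrable_of_hasCompactSupport
      (hρc.fderiv_apply ℝ _).mul_left
  have hint2 : ∀ j, Integrable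
      (fun x => fderiv ℝ (fun y => g y j) x (EuclideanSpace.single j 1) * ρ x) volume := fun j =>
    ((hcd _ _ (hgj j)).mul hρd.continuous).integrable_of_hasCompactSupport hρc.mul_left
  have hint3 : ∀ j, Integrable (fun x => g x j * ρ x) volume := fun j =>
    ((hgj j).continuous.mul hρd.continuous).integrable_of_hasCompactSupport hρc.mul_left
  have hs : ∀ x, l x * Complex.normSq (φ x)
      = ∑ j, fderiv ℝ (fun y => g y j) x (EuclideanSpace.single j 1) * ρ x := fun x => by
    rw [← hl, Finset.sum_mul]
  simp only [hs]
  rw [integral_finsetSum _ fun j _ => hint1 j, integral_finsetSum _ fun j _ => hint2 j,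
    ← Finset.sum_neg_distrib]
  refine Finset.sum_congr rfl fun j _ => ?_
  exact integral_mul_fderiv_eq_neg_fderiv_mul_of_integrable (hint2 j) (hint1 j) (hint3 j)
    (fun x _ => (hgj j).differentiable (by simp) x) fun x _ => hρd.differentiable (by simp) x

/-- Integration by parts: `2 Re ⟨-i (∇m) u, (p + A) u⟩ = -⟨(Δm) u, u⟩` on the domain of the closure
of `p + A`, with `g = ∇m` and `l = Δm`. -/
theorem two_mul_re_inner_mulFieldLp {A : Plane → Plane} {g : Plane → Plane} {l : Plane → ℝ}
    (hg : ContDiff ℝ ∞ g)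
    (hl : ∀ x, ∑ j, fderiv ℝ (fun y => g y j) x (EuclideanSpace.single j 1) = l x)
    (hgb : MemLp (momentumField g) ⊤ (volume : Measure Plane))
    (hlb : MemLp (fun x => (l x : ℂ)) ⊤ (volume : Measure Plane))
    {p : WithLp 2 (L2Scalar × L2Vector)} (hp : p ∈ (magneticMomentumGraph A).topologicalClosure) :
    2 * (⟪mulFieldLp hgb p.fst, p.snd⟫_ℂ).re + (⟪mulLp hlb p.fst, p.fst⟫_ℂ).re = 0 := by
  have c1 : Continuous fun p : WithLp 2 (L2Scalar × L2Vector) => p.fst :=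
    WithLp.continuous_fst 2 _ _
  have c2 : Continuous fun p : WithLp 2 (L2Scalar × L2Vector) => p.snd :=
    WithLp.continuous_snd 2 _ _
  refine closure_minimal (t := {p : WithLp 2 (L2Scalar × L2Vector) |
    2 * (⟪mulFieldLp hgb p.fst, p.snd⟫_ℂ).re + (⟪mulLp hlb p.fst, p.fst⟫_ℂ).re = 0}) ?_ ?_ hp
  · rintro z ⟨φ, hφ, h1, h2⟩
    have e1 : 2 * (⟪mulFieldLp hgb z.fst, z.snd⟫_ℂ).re
        = ∫ x, ∑ j, g x j
          * fderiv ℝ (fun y => Complex.normSq (φ y)) x (EuclideanSpace.single j 1) := by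
      rw [re_inner_eq_integral, ← integral_const_mul]
      refine integral_congr_ae ?_
      filter_upwards [coeFn_mulFieldLp hgb z.fst, h1, h2] with x e1 e2 e3
      rw [e1, e2, e3, two_mul_re_inner_momentumField A g hφ]
    have e2 : (⟪mulLp hlb z.fst, z.fst⟫_ℂ).re = ∫ x, l x * Complex.normSq (φ x) := by
      rw [re_inner_eq_integral]
      refine integral_congr_ae ?_
      filter_upwards [coeFn_mulLp hlb z.fst, h1] with x e1 e2
      rw [e1, e2, inner_smul_left, Complex.conj_ofReal, Complex.re_ofReal_mul, RCLike.inner_apply,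
        Complex.mul_conj, Complex.ofReal_re]
    change _ + _ = (0 : ℝ)
    rw [e1, e2, integral_gradient_mul_normSq hg hl hφ, neg_add_cancel]
  · refine isClosed_eq ?_ continuous_const
    have c3 := (Complex.continuous_re.comp
      (((mulFieldLp hgb).continuous.comp c1).inner (𝕜 := ℂ) c2)).const_mul 2
    exact c3.add (Complex.continuous_re.comp (((mulLp hlb).continuous.comp c1).inner (𝕜 := ℂ) c1))

end Graph

/-! ### The weight as a function of the squared distance in three dimensions -/

section RadialWeight

/-- `W(q) = 1 / (ε + q^{-1/2})`; the weight is `W(|x|² + a²)`. Its reciprocal is harmonic in the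
three variables `(x, a)`. -/
def radialWeight (ε q : ℝ) : ℝ := (ε + (√q)⁻¹)⁻¹

/-- Twice the derivative of `radialWeight`. -/
def radialWeightSlope (ε q : ℝ) : ℝ := (√q)⁻¹ ^ 3 * radialWeight ε q ^ 2

/-- Twice the derivative of `radialWeightSlope`. -/
def radialWeightCurv (ε q : ℝ) : ℝ :=
  -3 * ((√q)⁻¹ ^ 5 * radialWeight ε q ^ 2) + 2 * ((√q)⁻¹ ^ 6 * radialWeight ε q ^ 3)

/-- Twice the derivative of `radialWeightCurv`. -/
def radialWeightJerk (ε q : ℝ) : ℝ :=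
  15 * ((√q)⁻¹ ^ 7 * radialWeight ε q ^ 2) - 18 * ((√q)⁻¹ ^ 8 * radialWeight ε q ^ 3)
    + 6 * ((√q)⁻¹ ^ 9 * radialWeight ε q ^ 4)

variable {ε q : ℝ}

theorem hasDerivAt_inv_sqrt (hq : 0 < q) :
    HasDerivAt (fun q => (√q)⁻¹) (-((√q)⁻¹ ^ 3 / 2)) q := by
  have hs : √q ≠ 0 := (Real.sqrt_pos.2 hq).ne'
  convert! (Real.hasDerivAt_sqrt hq.ne').inv hs using 1
  field_simp

theorem add_inv_sqrt_pos (hε : 0 < ε) (q : ℝ) : 0 < ε + (√q)⁻¹ :=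
  add_pos_of_pos_of_nonneg hε (inv_nonneg.2 (Real.sqrt_nonneg q))

theorem radialWeight_pos (hε : 0 < ε) (q : ℝ) : 0 < radialWeight ε q :=
  inv_pos.2 (add_inv_sqrt_pos hε q)

theorem hasDerivAt_radialWeight (hε : 0 < ε) (hq : 0 < q) :
    HasDerivAt (radialWeight ε) (radialWeightSlope ε q / 2) q := by
  have h := (add_inv_sqrt_pos hε q).ne'
  convert! ((hasDerivAt_inv_sqrt hq).const_add ε).inv h using 1
  rw [radialWeightSlope, radialWeight]
  field_simp

theorem hasDerivAt_radialWeightSlope (hε : 0 < ε) (hq : 0 < q) :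
    HasDerivAt (radialWeightSlope ε) (radialWeightCurv ε q / 2) q := by
  convert! ((hasDerivAt_inv_sqrt hq).pow 3).mul ((hasDerivAt_radialWeight hε hq).pow 2) using 1
  simp only [radialWeightCurv, radialWeightSlope, Pi.pow_apply]
  ring

theorem hasDerivAt_radialWeightCurv (hε : 0 < ε) (hq : 0 < q) :
    HasDerivAt (radialWeightCurv ε) (radialWeightJerk ε q / 2) q := by
  have hk := hasDerivAt_inv_sqrt hq
  have hw := hasDerivAt_radialWeight hε hq
  convert! (((hk.pow 5).mul (hw.pow 2)).const_mul (-3)).add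
    (((hk.pow 6).mul (hw.pow 3)).const_mul 2) using 1
  simp only [radialWeightJerk, radialWeightSlope, Pi.pow_apply]
  ring

theorem radialWeight_le (hε : 0 < ε) (q : ℝ) : radialWeight ε q ≤ ε⁻¹ :=
  inv_anti₀ hε (le_add_of_nonneg_right (inv_nonneg.2 (Real.sqrt_nonneg q)))

theorem inv_sqrt_mul_radialWeight_le (hε : 0 < ε) (q : ℝ) : (√q)⁻¹ * radialWeight ε q ≤ 1 := by
  rw [radialWeight, ← div_eq_mul_inv, div_le_one (add_inv_sqrt_pos hε q)]
  exact le_add_of_nonneg_left hε.le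

theorem radialWeight_le_sqrt (hε : 0 < ε) (hq : 0 < q) : radialWeight ε q ≤ √q := by
  have h := inv_sqrt_mul_radialWeight_le hε q
  rwa [inv_mul_le_iff₀ (Real.sqrt_pos.2 hq), mul_one] at h

theorem radialWeightSlope_nonneg (ε q : ℝ) : 0 ≤ radialWeightSlope ε q := by
  rw [radialWeightSlope]
  positivity

/-- All weight derivatives are sums of such monomials, with `k = q^{-1/2}`, `w` the weight and `d`
either the height or `‖x‖`. Each factor `d` or `w` is paired with one factor `k`, and the surplus `k
^ j` remains. The constants in the bounds below are sums of absolute values of coefficients, as in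
`39 = 15 + 18 + 6`. -/
theorem pow_mul_pow_mul_pow_le {k w d : ℝ} {n i j : ℕ} (hk : 0 ≤ k) (hw : 0 ≤ w)
    (hd : 0 ≤ d) (hdk : d * k ≤ 1) (hkw : k * w ≤ 1) :
    |d ^ n * (k ^ (n + i + j) * w ^ i)| ≤ k ^ j := by
  have e : d ^ n * (k ^ (n + i + j) * w ^ i) = (d * k) ^ n * (k * w) ^ i * k ^ j := by ring
  rw [e, abs_of_nonneg (by positivity)]
  exact mul_le_of_le_one_left (by positivity) (mul_le_one₀ (pow_le_one₀ (by positivity) hdk)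
    (by positivity) (pow_le_one₀ (by positivity) hkw))

variable {d : ℝ}

theorem abs_mul_radialWeightSlope_le (hε : 0 < ε) (hd : 0 ≤ d) (hdq : d * (√q)⁻¹ ≤ 1) :
    |d * radialWeightSlope ε q| ≤ 1 := by
  have h := pow_mul_pow_mul_pow_le (n := 1) (i := 2) (j := 0) (inv_nonneg.2 (Real.sqrt_nonneg q))
    (radialWeight_pos hε q).le hd hdq (inv_sqrt_mul_radialWeight_le hε q)
  simpa [radialWeightSlope] using h

theorem abs_radialWeightSlope_le (hε : 0 < ε) : |radialWeightSlope ε q| ≤ (√q)⁻¹ := by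
  have h := pow_mul_pow_mul_pow_le (n := 0) (i := 2) (j := 1) (d := 0)
    (inv_nonneg.2 (Real.sqrt_nonneg q)) (radialWeight_pos hε q).le le_rfl (by simp)
    (inv_sqrt_mul_radialWeight_le hε q)
  simpa [radialWeightSlope] using h

theorem abs_sq_mul_radialWeightCurv_le (hε : 0 < ε) (hd : 0 ≤ d) (hdq : d * (√q)⁻¹ ≤ 1) :
    |d ^ 2 * radialWeightCurv ε q| ≤ 5 * (√q)⁻¹ := by
  have hk := inv_nonneg.2 (Real.sqrt_nonneg q)
  have hw := (radialWeight_pos hε q).le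
  have hkw := inv_sqrt_mul_radialWeight_le hε q
  have h1 := abs_le.1 (pow_mul_pow_mul_pow_le (n := 2) (i := 2) (j := 1) hk hw hd hdq hkw)
  have h2 := abs_le.1 (pow_mul_pow_mul_pow_le (n := 2) (i := 3) (j := 1) hk hw hd hdq hkw)
  norm_num only [pow_one] at h1 h2
  rw [radialWeightCurv, abs_le]
  constructor <;> linarith

theorem abs_mul_radialWeightCurv_le (hε : 0 < ε) (hd : 0 ≤ d) (hdq : d * (√q)⁻¹ ≤ 1) :
    |d * radialWeightCurv ε q| ≤ 5 * (√q)⁻¹ ^ 2 := by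
  have hk := inv_nonneg.2 (Real.sqrt_nonneg q)
  have hw := (radialWeight_pos hε q).le
  have hkw := inv_sqrt_mul_radialWeight_le hε q
  have h1 := abs_le.1 (pow_mul_pow_mul_pow_le (n := 1) (i := 2) (j := 2) hk hw hd hdq hkw)
  have h2 := abs_le.1 (pow_mul_pow_mul_pow_le (n := 1) (i := 3) (j := 2) hk hw hd hdq hkw)
  norm_num only [pow_one] at h1 h2
  rw [radialWeightCurv, abs_le]
  constructor <;> linarith

theorem abs_cube_mul_radialWeightJerk_le (hε : 0 < ε) (hd : 0 ≤ d) (hdq : d * (√q)⁻¹ ≤ 1) :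
    |d ^ 3 * radialWeightJerk ε q| ≤ 39 * (√q)⁻¹ ^ 2 := by
  have hk := inv_nonneg.2 (Real.sqrt_nonneg q)
  have hw := (radialWeight_pos hε q).le
  have hkw := inv_sqrt_mul_radialWeight_le hε q
  have h1 := abs_le.1 (pow_mul_pow_mul_pow_le (n := 3) (i := 2) (j := 2) hk hw hd hdq hkw)
  have h2 := abs_le.1 (pow_mul_pow_mul_pow_le (n := 3) (i := 3) (j := 2) hk hw hd hdq hkw)
  have h3 := abs_le.1 (pow_mul_pow_mul_pow_le (n := 3) (i := 4) (j := 2) hk hw hd hdq hkw)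
  norm_num only at h1 h2 h3
  rw [radialWeightJerk, abs_le]
  constructor <;> linarith

/-- The reciprocal of the weight is harmonic in `(x, a)`, so that
`Δw = 2 |∇w|² / w` in these three variables. -/
theorem radialWeight_laplacian_eq (ε : ℝ) (hq : 0 < q) :
    radialWeight ε q * (3 * radialWeightSlope ε q + q * radialWeightCurv ε q)
      = 2 * (q * radialWeightSlope ε q ^ 2) := by
  have hs := Real.sqrt_pos.2 hq
  obtain ⟨s, hs0, rfl⟩ : ∃ s, 0 < s ∧ q = s ^ 2 := ⟨√q, hs, (Real.sq_sqrt hq.le).symm⟩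
  rw [radialWeightCurv, radialWeightSlope, Real.sqrt_sq hs0.le]
  field_simp
  ring

end RadialWeight

/-! ### The weight on horizontal planes: derivatives and bounds -/

section PlaneWeight

variable {ε a : ℝ}

/-- The weight on the plane at height `a`, a bounded regularization of `|x|`. -/
def planeWeight (ε a : ℝ) (x : Plane) : ℝ := radialWeight ε (‖x‖ ^ 2 + a ^ 2)

/-- The first derivative of `planeWeight` in `a`. -/
def planeWeight₁ (ε a : ℝ) (x : Plane) : ℝ := a * radialWeightSlope ε (‖x‖ ^ 2 + a ^ 2)

/-- The second derivative of `planeWeight` in `a`. -/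
def planeWeight₂ (ε a : ℝ) (x : Plane) : ℝ :=
  radialWeightSlope ε (‖x‖ ^ 2 + a ^ 2) + a ^ 2 * radialWeightCurv ε (‖x‖ ^ 2 + a ^ 2)

/-- The third derivative of `planeWeight` in `a`. -/
def planeWeight₃ (ε a : ℝ) (x : Plane) : ℝ :=
  3 * (a * radialWeightCurv ε (‖x‖ ^ 2 + a ^ 2))
    + a ^ 3 * radialWeightJerk ε (‖x‖ ^ 2 + a ^ 2)

/-- The gradient of `planeWeight` in the plane. -/
def planeWeightGradient (ε a : ℝ) (x : Plane) : Plane :=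
  radialWeightSlope ε (‖x‖ ^ 2 + a ^ 2) • x

/-- The Laplacian of `planeWeight` in the plane. -/
def planeWeightLaplacian (ε a : ℝ) (x : Plane) : ℝ :=
  2 * radialWeightSlope ε (‖x‖ ^ 2 + a ^ 2) + ‖x‖ ^ 2 * radialWeightCurv ε (‖x‖ ^ 2 + a ^ 2)

theorem norm_sq_add_sq_pos (x : Plane) (ha : 0 < a) : 0 < ‖x‖ ^ 2 + a ^ 2 := by positivity

theorem hasDerivAt_const_add_sq (c a : ℝ) : HasDerivAt (fun a => c + a ^ 2) (2 * a) a := by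
  simpa using (hasDerivAt_pow 2 a).const_add c

theorem hasDerivAt_planeWeight (hε : 0 < ε) (ha : 0 < a) (x : Plane) :
    HasDerivAt (fun a => planeWeight ε a x) (planeWeight₁ ε a x) a := by
  have h := (hasDerivAt_radialWeight hε (norm_sq_add_sq_pos x ha)).comp a
    (hasDerivAt_const_add_sq (‖x‖ ^ 2) a)
  convert! h using 1
  rw [planeWeight₁]
  ring

theorem hasDerivAt_planeWeight₁ (hε : 0 < ε) (ha : 0 < a) (x : Plane) :
    HasDerivAt (fun a => planeWeight₁ ε a x) (planeWeight₂ ε a x) a := by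
  have h := (hasDerivAt_id a).mul ((hasDerivAt_radialWeightSlope hε (norm_sq_add_sq_pos x ha)).comp a
    (hasDerivAt_const_add_sq (‖x‖ ^ 2) a))
  convert! h using 1
  simp only [planeWeight₂, Function.comp, id]
  ring

theorem hasDerivAt_planeWeight₂ (hε : 0 < ε) (ha : 0 < a) (x : Plane) :
    HasDerivAt (fun a => planeWeight₂ ε a x) (planeWeight₃ ε a x) a := by
  have h1 := (hasDerivAt_radialWeightSlope hε (norm_sq_add_sq_pos x ha)).comp a
    (hasDerivAt_const_add_sq (‖x‖ ^ 2) a)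
  have h2 := (hasDerivAt_radialWeightCurv hε (norm_sq_add_sq_pos x ha)).comp a
    (hasDerivAt_const_add_sq (‖x‖ ^ 2) a)
  convert! h1.add ((hasDerivAt_pow 2 a).mul h2) using 1
  simp only [planeWeight₃, Function.comp]
  push_cast
  ring

theorem inv_sqrt_norm_sq_add_sq_le (x : Plane) (ha : 0 < a) :
    (√(‖x‖ ^ 2 + a ^ 2))⁻¹ ≤ a⁻¹ :=
  inv_anti₀ ha (Real.le_sqrt_of_sq_le (le_add_of_nonneg_left (sq_nonneg _)))

theorem mul_inv_sqrt_norm_sq_add_sq_le (x : Plane) (ha : 0 < a) :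
    a * (√(‖x‖ ^ 2 + a ^ 2))⁻¹ ≤ 1 := by
  rw [← div_eq_mul_inv, div_le_one (Real.sqrt_pos.2 (norm_sq_add_sq_pos x ha))]
  exact Real.le_sqrt_of_sq_le (le_add_of_nonneg_left (sq_nonneg _))

theorem norm_mul_inv_sqrt_norm_sq_add_sq_le (x : Plane) (ha : 0 < a) :
    ‖x‖ * (√(‖x‖ ^ 2 + a ^ 2))⁻¹ ≤ 1 := by
  rw [← div_eq_mul_inv, div_le_one (Real.sqrt_pos.2 (norm_sq_add_sq_pos x ha))]
  exact Real.le_sqrt_of_sq_le (le_add_of_nonneg_right (sq_nonneg _))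

theorem abs_planeWeight_le (hε : 0 < ε) (a : ℝ) (x : Plane) : |planeWeight ε a x| ≤ ε⁻¹ := by
  rw [planeWeight, abs_of_pos (radialWeight_pos hε _)]
  exact radialWeight_le hε _

theorem abs_planeWeight₁_le (hε : 0 < ε) (ha : 0 < a) (x : Plane) : |planeWeight₁ ε a x| ≤ 1 :=
  abs_mul_radialWeightSlope_le hε ha.le (mul_inv_sqrt_norm_sq_add_sq_le x ha)

theorem abs_planeWeight₂_le (hε : 0 < ε) (ha : 0 < a) (x : Plane) :
    |planeWeight₂ ε a x| ≤ 6 * a⁻¹ := by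
  have h1 := abs_radialWeightSlope_le hε (q := ‖x‖ ^ 2 + a ^ 2)
  have h2 := abs_sq_mul_radialWeightCurv_le hε ha.le (mul_inv_sqrt_norm_sq_add_sq_le x ha)
  have h3 := inv_sqrt_norm_sq_add_sq_le x ha
  rw [planeWeight₂]
  linarith [abs_add_le (radialWeightSlope ε (‖x‖ ^ 2 + a ^ 2))
    (a ^ 2 * radialWeightCurv ε (‖x‖ ^ 2 + a ^ 2))]

theorem abs_planeWeight₃_le (hε : 0 < ε) (ha : 0 < a) (x : Plane) :
    |planeWeight₃ ε a x| ≤ 54 * a⁻¹ ^ 2 := by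
  have h1 := abs_mul_radialWeightCurv_le hε ha.le (mul_inv_sqrt_norm_sq_add_sq_le x ha)
  have h2 := abs_cube_mul_radialWeightJerk_le hε ha.le (mul_inv_sqrt_norm_sq_add_sq_le x ha)
  have h3 : (√(‖x‖ ^ 2 + a ^ 2))⁻¹ ^ 2 ≤ a⁻¹ ^ 2 :=
    pow_le_pow_left₀ (inv_nonneg.2 (Real.sqrt_nonneg _)) (inv_sqrt_norm_sq_add_sq_le x ha) 2
  have h4 := abs_add_le (3 * (a * radialWeightCurv ε (‖x‖ ^ 2 + a ^ 2)))
    (a ^ 3 * radialWeightJerk ε (‖x‖ ^ 2 + a ^ 2))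
  rw [abs_mul, abs_of_pos (three_pos : (0 : ℝ) < 3)] at h4
  rw [planeWeight₃]
  linarith

theorem abs_planeWeightLaplacian_le (hε : 0 < ε) (ha : 0 < a) (x : Plane) :
    |planeWeightLaplacian ε a x| ≤ 7 * a⁻¹ := by
  have h1 := abs_radialWeightSlope_le hε (q := ‖x‖ ^ 2 + a ^ 2)
  have h2 := abs_sq_mul_radialWeightCurv_le hε (norm_nonneg x)
    (norm_mul_inv_sqrt_norm_sq_add_sq_le x ha)
  have h3 := inv_sqrt_norm_sq_add_sq_le x ha
  have h4 := abs_add_le (2 * radialWeightSlope ε (‖x‖ ^ 2 + a ^ 2))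
    (‖x‖ ^ 2 * radialWeightCurv ε (‖x‖ ^ 2 + a ^ 2))
  rw [abs_mul, abs_of_pos (two_pos : (0 : ℝ) < 2)] at h4
  rw [planeWeightLaplacian]
  linarith

theorem norm_planeWeightGradient_le (hε : 0 < ε) (ha : 0 < a) (x : Plane) :
    ‖planeWeightGradient ε a x‖ ≤ 1 := by
  rw [planeWeightGradient, norm_smul, Real.norm_eq_abs, ← abs_of_nonneg (norm_nonneg x), ← abs_mul,
    mul_comm, abs_of_nonneg (norm_nonneg x)]
  exact abs_mul_radialWeightSlope_le hε (norm_nonneg x) (norm_mul_inv_sqrt_norm_sq_add_sq_le x ha)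

theorem contDiff_inv_sqrt_norm_sq_add_sq (ha : 0 < a) :
    ContDiff ℝ ∞ fun x : Plane => (√(‖x‖ ^ 2 + a ^ 2))⁻¹ :=
  (((contDiff_norm_sq ℝ).add contDiff_const).sqrt fun x => (norm_sq_add_sq_pos x ha).ne').inv
    fun x => (Real.sqrt_pos.2 (norm_sq_add_sq_pos x ha)).ne'

theorem contDiff_planeWeight (hε : 0 < ε) (ha : 0 < a) : ContDiff ℝ ∞ (planeWeight ε a) :=
  (contDiff_const.add (contDiff_inv_sqrt_norm_sq_add_sq ha)).inv fun _ =>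
    (add_inv_sqrt_pos hε _).ne'

theorem contDiff_radialWeightSlope (hε : 0 < ε) (ha : 0 < a) :
    ContDiff ℝ ∞ fun x : Plane => radialWeightSlope ε (‖x‖ ^ 2 + a ^ 2) :=
  ((contDiff_inv_sqrt_norm_sq_add_sq ha).pow 3).mul ((contDiff_planeWeight hε ha).pow 2)

theorem contDiff_planeWeightGradient (hε : 0 < ε) (ha : 0 < a) :
    ContDiff ℝ ∞ (planeWeightGradient ε a) :=
  (contDiff_radialWeightSlope hε ha).smul contDiff_id

theorem continuous_radialWeightCurv (hε : 0 < ε) (ha : 0 < a) :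
    Continuous fun x : Plane => radialWeightCurv ε (‖x‖ ^ 2 + a ^ 2) := by
  have h1 := (contDiff_inv_sqrt_norm_sq_add_sq ha).continuous
  have h2 : Continuous fun x : Plane => radialWeight ε (‖x‖ ^ 2 + a ^ 2) :=
    (contDiff_planeWeight hε ha).continuous
  exact (((h1.pow 5).mul (h2.pow 2)).const_mul _).add (((h1.pow 6).mul (h2.pow 3)).const_mul _)

theorem continuous_planeWeight₁ (hε : 0 < ε) (ha : 0 < a) : Continuous (planeWeight₁ ε a) :=
  (contDiff_radialWeightSlope hε ha).continuous.const_mul _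

theorem continuous_planeWeight₂ (hε : 0 < ε) (ha : 0 < a) : Continuous (planeWeight₂ ε a) :=
  (contDiff_radialWeightSlope hε ha).continuous.add
    ((continuous_radialWeightCurv hε ha).const_mul _)

theorem continuous_planeWeightLaplacian (hε : 0 < ε) (ha : 0 < a) :
    Continuous (planeWeightLaplacian ε a) :=
  ((contDiff_radialWeightSlope hε ha).continuous.const_mul _).add
    ((continuous_norm.pow 2).mul (continuous_radialWeightCurv hε ha))

theorem hasFDerivAt_comp_norm_sq_add_sq {f : ℝ → ℝ} {f' : ℝ} {x : Plane}
    (hf : HasDerivAt f (f' / 2) (‖x‖ ^ 2 + a ^ 2)) :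
    HasFDerivAt (fun x : Plane => f (‖x‖ ^ 2 + a ^ 2)) (f' • innerSL ℝ x) x := by
  have h := hf.comp_hasFDerivAt x ((hasStrictFDerivAt_norm_sq x).hasFDerivAt.add_const (a ^ 2))
  convert! h using 1
  ext y
  simp only [_root_.smul_apply, smul_eq_mul, nsmul_eq_mul]
  push_cast
  ring

theorem innerSL_single (x : Plane) (j : Fin 2) :
    innerSL ℝ x (EuclideanSpace.single j 1) = x j := by
  simp [EuclideanSpace.inner_single_right]

theorem fderiv_planeWeight (hε : 0 < ε) (ha : 0 < a) (x : Plane) (j : Fin 2) :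
    fderiv ℝ (planeWeight ε a) x (EuclideanSpace.single j 1) = planeWeightGradient ε a x j := by
  have h := hasFDerivAt_comp_norm_sq_add_sq (hasDerivAt_radialWeight hε (norm_sq_add_sq_pos x ha))
  rw [show planeWeight ε a = fun x => radialWeight ε (‖x‖ ^ 2 + a ^ 2) from rfl, h.fderiv,
    _root_.smul_apply, innerSL_single]
  rfl

theorem sum_fderiv_planeWeightGradient (hε : 0 < ε) (ha : 0 < a) (x : Plane) :
    ∑ j, fderiv ℝ (fun y => planeWeightGradient ε a y j) x (EuclideanSpace.single j 1)
      = planeWeightLaplacian ε a x := by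
  have h := hasFDerivAt_comp_norm_sq_add_sq
    (hasDerivAt_radialWeightSlope hε (norm_sq_add_sq_pos x ha))
  have hj : ∀ j, fderiv ℝ (fun y => planeWeightGradient ε a y j) x (EuclideanSpace.single j 1)
      = radialWeightSlope ε (‖x‖ ^ 2 + a ^ 2)
        + radialWeightCurv ε (‖x‖ ^ 2 + a ^ 2) * x j ^ 2 := by
    intro j
    have hp : HasFDerivAt (fun y : Plane => y j) (EuclideanSpace.proj (𝕜 := ℝ) j) x :=
      (EuclideanSpace.proj (𝕜 := ℝ) j : Plane →L[ℝ] ℝ).hasFDerivAt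
    have h2 := (h.mul hp).fderiv
    rw [show (fun y => planeWeightGradient ε a y j)
      = (fun y : Plane => radialWeightSlope ε (‖y‖ ^ 2 + a ^ 2)) * fun y => y j from rfl, h2]
    have h3 : EuclideanSpace.proj (𝕜 := ℝ) j (EuclideanSpace.single j (1 : ℝ)) = (1 : ℝ) := by simp
    simp only [_root_.add_apply, _root_.smul_apply, innerSL_single, smul_eq_mul, h3]
    ring
  simp only [hj]
  rw [planeWeightLaplacian, EuclideanSpace.real_norm_sq_eq]
  simp only [Fin.sum_univ_two]
  ring

/-- The identity `w Δw = 2 |∇w|²` in three variables, with Laplacian and gradient split into their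
vertical and planar parts. It is exactly the condition for completing the squares in
`weighted_square_nonneg`. -/
theorem planeWeight_mul_laplacian_eq (ε : ℝ) (ha : 0 < a) (x : Plane) :
    planeWeight ε a x * (planeWeight₂ ε a x + planeWeightLaplacian ε a x)
      = 2 * (planeWeight₁ ε a x ^ 2 + ‖planeWeightGradient ε a x‖ ^ 2) := by
  have h := radialWeight_laplacian_eq ε (norm_sq_add_sq_pos x ha)
  rw [planeWeight, planeWeight₂, planeWeightLaplacian, planeWeight₁, planeWeightGradient,
    norm_smul, Real.norm_eq_abs, mul_pow, mul_pow, sq_abs]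
  linear_combination h

end PlaneWeight

/-! ### Differentiable families of multiplication operators -/

section WeightOperator

variable {f f₁ f₂ : ℝ → Plane → ℝ}

/-- A family of bounded functions `f t`, `t > 0`, as a family of multiplication operators. -/
def weightOperator (hf : ∀ t, 0 < t → MemLp (fun x => (f t x : ℂ)) ⊤ (volume : Measure Plane))
    (t : ℝ) : L2Scalar →L[ℂ] L2Scalar :=
  -- The value `0` for `t ≤ 0` keeps the operator symmetric at every `t`.
  if h : 0 < t then mulLp (hf t h) else 0

theorem weightOperator_of_pos
    (hf : ∀ t, 0 < t → MemLp (fun x => (f t x : ℂ)) ⊤ (volume : Measure Plane)) {t : ℝ}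
    (ht : 0 < t) : weightOperator hf t = mulLp (hf t ht) :=
  dif_pos ht

theorem inner_weightOperator
    (hf : ∀ t, 0 < t → MemLp (fun x => (f t x : ℂ)) ⊤ (volume : Measure Plane)) (t : ℝ)
    (u v : L2Scalar) : ⟪weightOperator hf t u, v⟫_ℂ = ⟪u, weightOperator hf t v⟫_ℂ := by
  by_cases ht : 0 < t
  · rw [weightOperator_of_pos hf ht, inner_mulLp_ofReal]
  · simp [weightOperator, dif_neg ht]

/-- The scalar Taylor bound is uniform in `x`, and a multiplication operator has norm at most the
supremum of its multiplier. -/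
theorem hasQuadraticRemainder_weightOperator
    (hf : ∀ t, 0 < t → MemLp (fun x => (f t x : ℂ)) ⊤ (volume : Measure Plane))
    (hf₁ : ∀ t, 0 < t → MemLp (fun x => (f₁ t x : ℂ)) ⊤ (volume : Measure Plane))
    (h₀ : ∀ t x, 0 < t → HasDerivAt (fun t => f t x) (f₁ t x) t)
    (h₁ : ∀ t x, 0 < t → HasDerivAt (fun t => f₁ t x) (f₂ t x) t)
    (hC : ∀ a, 0 < a → ∃ C, ∀ t x, a < t → |f₂ t x| ≤ C) :
    HasQuadraticRemainder (weightOperator hf) (weightOperator hf₁) := by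
  intro a ha
  obtain ⟨C, hC⟩ := hC a ha
  refine ⟨C, fun s t hs ht => ?_⟩
  have hs0 := ha.trans hs
  have ht0 := ha.trans ht
  have hC0 : 0 ≤ C := (abs_nonneg _).trans (hC t 0 ht)
  rw [weightOperator_of_pos hf hs0, weightOperator_of_pos hf ht0, weightOperator_of_pos hf₁ ht0]
  refine norm_clm_le_of_coeFn (m := fun x => ((f s x - f t x - (s - t) * f₁ t x : ℝ) : ℂ))
    (by positivity) (fun u => ?_) fun x => ?_
  · set B₁ := mulLp (E := ℂ) (hf s hs0)
    set B₂ := mulLp (E := ℂ) (hf t ht0)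
    set B₃ := mulLp (E := ℂ) (hf₁ t ht0)
    filter_upwards [coeFn_mulLp (hf s hs0) u, coeFn_mulLp (hf t ht0) u, coeFn_mulLp (hf₁ t ht0) u,
      Lp.coeFn_sub (B₁ u - B₂ u) (((s - t : ℝ) : ℂ) • B₃ u), Lp.coeFn_sub (B₁ u) (B₂ u),
      Lp.coeFn_smul ((s - t : ℝ) : ℂ) (B₃ u)] with x e1 e2 e3 e4 e5 e6
    change ((B₁ u - B₂ u - ((s - t : ℝ) : ℂ) • B₃ u : L2Scalar) : Plane → ℂ) x = _
    rw [e4, Pi.sub_apply, e5, Pi.sub_apply, e6, Pi.smul_apply, e1, e2, e3]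
    simp only [smul_eq_mul]
    push_cast
    ring
  · rw [Complex.norm_real, Real.norm_eq_abs]
    exact abs_taylor_le (f := fun t => f t x) (f₁ := fun t => f₁ t x) (f₂ := fun t => f₂ t x)
      (a := a) (fun u hu => h₀ u x (ha.trans hu)) (fun u hu => h₁ u x (ha.trans hu))
      (fun u hu => hC u x hu) hs ht

end WeightOperator

/-! ### Completing the squares for the regularized weight -/

section Positivity

/-- Multiplied by `w`, the expression is `2 |w₁ u - w y|² + 2 ‖u V + w p‖²`: the squares absorb `4 w
w₁ Re ⟨u, y⟩` and `4 w Re ⟨u V, p⟩`, and the hypothesis `h` matches the coefficient of `|u|²`. -/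
theorem weighted_square_nonneg {E : Type*} [NormedAddCommGroup E] [InnerProductSpace ℂ E]
    {w w₁ b g : ℝ} (hw : 0 < w) (u y : ℂ) (V p : E) (hV : ‖V‖ = g)
    (h : w * b = 2 * (w₁ ^ 2 + g ^ 2)) :
    0 ≤ b * ‖u‖ ^ 2 - 4 * (w₁ * (⟪u, y⟫_ℂ).re) + 2 * (w * ‖y‖ ^ 2) + 2 * (w * ‖p‖ ^ 2)
      + 4 * (⟪u • V, p⟫_ℂ).re := by
  have h1 : ‖(w₁ : ℂ) * u - (w : ℂ) * y‖ ^ 2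
      = w₁ ^ 2 * ‖u‖ ^ 2 - 2 * (w * w₁ * (⟪u, y⟫_ℂ).re) + w ^ 2 * ‖y‖ ^ 2 := by
    have h := norm_sub_sq (𝕜 := ℂ) ((w₁ : ℂ) • u) ((w : ℂ) • y)
    rw [inner_smul_left, inner_smul_right, Complex.conj_ofReal] at h
    simp only [RCLike.re_to_complex, Complex.re_ofReal_mul, norm_mul, mul_pow, Complex.norm_real,
      Real.norm_eq_abs, sq_abs, smul_eq_mul] at h
    rw [h]
    ring
  have h2 : ‖u • V + (w : ℂ) • p‖ ^ 2
      = ‖u‖ ^ 2 * g ^ 2 + 2 * (w * (⟪u • V, p⟫_ℂ).re) + w ^ 2 * ‖p‖ ^ 2 := by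
    have h := norm_add_sq (𝕜 := ℂ) (u • V) ((w : ℂ) • p)
    rw [inner_smul_right] at h
    simp only [RCLike.re_to_complex, Complex.re_ofReal_mul, norm_smul, mul_pow, Complex.norm_real,
      Real.norm_eq_abs, sq_abs, hV] at h
    exact h
  refine nonneg_of_mul_nonneg_right (a := w) ?_ hw
  have h3 : w * (b * ‖u‖ ^ 2 - 4 * (w₁ * (⟪u, y⟫_ℂ).re) + 2 * (w * ‖y‖ ^ 2) + 2 * (w * ‖p‖ ^ 2)
      + 4 * (⟪u • V, p⟫_ℂ).re)
      = 2 * ‖(w₁ : ℂ) * u - (w : ℂ) * y‖ ^ 2 + 2 * ‖u • V + (w : ℂ) • p‖ ^ 2 := by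
    rw [h1, h2]
    linear_combination ‖u‖ ^ 2 * h
  rw [h3]
  positivity

theorem re_inner_mulLp_eq_integral {E : Type*} [NormedAddCommGroup E] [InnerProductSpace ℂ E]
    {m : Plane → ℝ} (hm : MemLp (fun x => (m x : ℂ)) ⊤ (volume : Measure Plane))
    (u v : Lp E 2 (volume : Measure Plane)) :
    (⟪mulLp hm u, v⟫_ℂ).re = ∫ x, m x * (⟪u x, v x⟫_ℂ).re := by
  rw [re_inner_eq_integral]
  refine integral_congr_ae ?_
  filter_upwards [coeFn_mulLp hm u] with x hx
  rw [hx, inner_smul_left, Complex.conj_ofReal, Complex.re_ofReal_mul]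

theorem integrable_mul_re_inner {E : Type*} [NormedAddCommGroup E] [InnerProductSpace ℂ E]
    {m : Plane → ℝ} (hm : MemLp (fun x => (m x : ℂ)) ⊤ (volume : Measure Plane))
    (u v : Lp E 2 (volume : Measure Plane)) :
    Integrable (fun x => m x * (⟪u x, v x⟫_ℂ).re) := by
  refine (integrable_re_inner (mulLp hm u) v).congr ?_
  filter_upwards [coeFn_mulLp hm u] with x hx
  rw [hx, inner_smul_left, Complex.conj_ofReal, Complex.re_ofReal_mul]

variable {A : Plane → Plane} {ε : ℝ}

/-- Convexity of `⟨w_t u_t, u_t⟩` for `u_t = exp (-t |D|) ψ`, with `p = (u, D u)`, `y = |D| u` and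
`f = |D|² u`. -/
theorem planeWeight_convexity (hε : 0 < ε) {t : ℝ} (ht : 0 < t)
    (h₀ : MemLp (fun x => (planeWeight ε t x : ℂ)) ⊤ (volume : Measure Plane))
    (h₁ : MemLp (fun x => (planeWeight₁ ε t x : ℂ)) ⊤ (volume : Measure Plane))
    (h₂ : MemLp (fun x => (planeWeight₂ ε t x : ℂ)) ⊤ (volume : Measure Plane))
    {p : WithLp 2 (L2Scalar × L2Vector)} (hp : p ∈ (magneticMomentumGraph A).topologicalClosure)
    (y f : L2Scalar) (hf : ∀ z ∈ (magneticMomentumGraph A).topologicalClosure,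
      ⟪z.fst, f⟫_ℂ = ⟪z.snd, p.snd⟫_ℂ) :
    0 ≤ (⟪mulLp h₂ p.fst, p.fst⟫_ℂ).re - 4 * (⟪mulLp h₁ p.fst, y⟫_ℂ).re
      + 2 * (⟪mulLp h₀ y, y⟫_ℂ).re + 2 * (⟪mulLp h₀ p.fst, f⟫_ℂ).re := by
  have hg := memLp_top_momentumField (contDiff_planeWeightGradient hε ht).continuous
    (norm_planeWeightGradient_le hε ht)
  have hl := memLp_top_ofReal (continuous_planeWeightLaplacian hε ht)
    (abs_planeWeightLaplacian_le hε ht)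
  -- The weak equation is tested with the pair `(w u, D(w u))`, where `D(w u) = w D u - i ∇w u`.
  have e1 : ⟪mulLp h₀ p.fst, f⟫_ℂ = ⟪mulLp h₀ p.snd + mulFieldLp hg p.fst, p.snd⟫_ℂ :=
    hf _ (mul_mem_closure_magneticMomentumGraph (contDiff_planeWeight hε ht)
      (fderiv_planeWeight hε ht) h₀ hg hp)
  have e2 := two_mul_re_inner_mulFieldLp (A := A) (contDiff_planeWeightGradient hε ht)
    (sum_fderiv_planeWeightGradient hε ht) hg hl hp
  rw [e1, inner_add_left, Complex.add_re]
  have hself : ∀ {E : Type} [NormedAddCommGroup E] [InnerProductSpace ℂ E] (v : E),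
      (⟪v, v⟫_ℂ).re = ‖v‖ ^ 2 := fun v => inner_self_eq_norm_sq (𝕜 := ℂ) v
  have i1 := integrable_mul_re_inner h₂ p.fst p.fst
  have i2 := integrable_mul_re_inner hl p.fst p.fst
  have i3 := integrable_mul_re_inner h₁ p.fst y
  have i4 := integrable_mul_re_inner h₀ y y
  have i5 := integrable_mul_re_inner h₀ p.snd p.snd
  have i6 := integrable_re_inner (mulFieldLp hg p.fst) p.snd
  -- The cross term is written as `2X = 4X - 2X`, and `e2` replaces `-2X` by `⟨(Δw) u, u⟩`. This
  -- joins the planar Laplacian to the second vertical derivative and leaves the factor 4 needed for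
  -- the square.
  have e3 : (⟪mulLp h₂ p.fst, p.fst⟫_ℂ).re - 4 * (⟪mulLp h₁ p.fst, y⟫_ℂ).re
      + 2 * (⟪mulLp h₀ y, y⟫_ℂ).re
      + 2 * ((⟪mulLp h₀ p.snd, p.snd⟫_ℂ).re + (⟪mulFieldLp hg p.fst, p.snd⟫_ℂ).re)
      = ∫ x, (planeWeight₂ ε t x * (⟪p.fst x, p.fst x⟫_ℂ).re
          + planeWeightLaplacian ε t x * (⟪p.fst x, p.fst x⟫_ℂ).re
          - 4 * (planeWeight₁ ε t x * (⟪p.fst x, y x⟫_ℂ).re)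
          + 2 * (planeWeight ε t x * (⟪y x, y x⟫_ℂ).re)
          + 2 * (planeWeight ε t x * (⟪p.snd x, p.snd x⟫_ℂ).re)
          + 4 * (⟪mulFieldLp hg p.fst x, p.snd x⟫_ℂ).re) := by
    symm
    have i12 := i1.add i2
    have i123 := i12.sub (i3.const_mul 4)
    have i1234 := i123.add (i4.const_mul 2)
    have i12345 := i1234.add (i5.const_mul 2)
    refine (integral_add' i12345 (i6.const_mul 4)).trans ?_
    rw [integral_add' i1234 (i5.const_mul 2), integral_add' i123 (i4.const_mul 2),
      integral_sub' i12 (i3.const_mul 4), integral_add' i1 i2]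
    simp only [integral_const_mul]
    have r1 := re_inner_mulLp_eq_integral h₂ p.fst p.fst
    have r2 := re_inner_mulLp_eq_integral hl p.fst p.fst
    have r3 := re_inner_mulLp_eq_integral h₁ p.fst y
    have r4 := re_inner_mulLp_eq_integral h₀ y y
    have r5 := re_inner_mulLp_eq_integral h₀ p.snd p.snd
    have r6 := re_inner_eq_integral (mulFieldLp hg p.fst) p.snd
    rw [r2] at e2
    rw [r1, r3, r4, r5]
    rw [r6] at e2 ⊢
    linarith
  rw [e3]
  refine integral_nonneg_of_ae ?_
  filter_upwards [coeFn_mulFieldLp hg p.fst] with x hx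
  rw [hx, hself, hself, hself, ← add_mul]
  exact weighted_square_nonneg (radialWeight_pos hε _) _ _ _ _ (norm_momentumField _ x)
    (planeWeight_mul_laplacian_eq ε ht x)

theorem re_inner_planeWeight_modulus_nonneg (hA : IsL2Loc A) (hε : 0 < ε) {t : ℝ} (ht : 0 < t)
    (hm : MemLp (fun x => (planeWeight ε t x : ℂ)) ⊤ (volume : Measure Plane)) {z : L2Scalar × L2Scalar}
    (hz : z ∈ modulusGraph (magneticMomentumGraph A)) : 0 ≤ (⟪mulLp hm z.1, z.2⟫_ℂ).re := by
  have h₀ : ∀ t, 0 < t → MemLp (fun x => (planeWeight ε t x : ℂ)) ⊤ (volume : Measure Plane) :=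
    fun t ht => memLp_top_ofReal (contDiff_planeWeight hε ht).continuous (abs_planeWeight_le hε t)
  have h₁ : ∀ t, 0 < t → MemLp (fun x => (planeWeight₁ ε t x : ℂ)) ⊤ (volume : Measure Plane) :=
    fun t ht => memLp_top_ofReal (continuous_planeWeight₁ hε ht) (abs_planeWeight₁_le hε ht)
  have h₂ : ∀ t, 0 < t → MemLp (fun x => (planeWeight₂ ε t x : ℂ)) ⊤ (volume : Measure Plane) :=
    fun t ht => memLp_top_ofReal (continuous_planeWeight₂ hε ht) (abs_planeWeight₂_le hε ht)
  have h := re_inner_weight_modulus_nonneg (G := magneticMomentumGraph A)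
    (magneticMomentumGraph_dense hA) (W := weightOperator h₀) (W₁ := weightOperator h₁)
    (W₂ := weightOperator h₂) (C := ε⁻¹)
    (hasQuadraticRemainder_weightOperator h₀ h₁
      (fun t x ht => hasDerivAt_planeWeight hε ht x) (fun t x ht => hasDerivAt_planeWeight₁ hε ht x)
      fun a ha => ⟨6 * a⁻¹, fun t x hat =>
        (abs_planeWeight₂_le hε (ha.trans hat) x).trans (by gcongr)⟩)
    (hasQuadraticRemainder_weightOperator h₁ h₂
      (fun t x ht => hasDerivAt_planeWeight₁ hε ht x)
      (fun t x ht => hasDerivAt_planeWeight₂ hε ht x)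
      fun a ha => ⟨54 * a⁻¹ ^ 2, fun t x hat =>
        (abs_planeWeight₃_le hε (ha.trans hat) x).trans (by
          have := ha.trans hat
          gcongr)⟩)
    (fun t ht => by
      rw [weightOperator_of_pos h₀ ht]
      exact norm_clm_le_of_coeFn (inv_nonneg.2 hε.le) (coeFn_mulLp (h₀ t ht)) fun x => by
        simpa using abs_planeWeight_le hε t x)
    (inner_weightOperator h₀) (inner_weightOperator h₁)
    (fun t x ht => by
      rw [weightOperator_of_pos h₁ ht]
      exact re_inner_mulLp_nonneg _ (fun x => mul_nonneg ht.le (radialWeightSlope_nonneg _ _)) x)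
    (fun t ht p hp y f hf => by
      rw [weightOperator_of_pos h₀ ht, weightOperator_of_pos h₁ ht, weightOperator_of_pos h₂ ht]
      exact planeWeight_convexity hε ht _ _ _ hp y f hf)
    ht hz
  rwa [weightOperator_of_pos h₀ ht] at h

end Positivity

/-! ### Dominated convergence in `L²` -/

section DominatedConvergence

variable {X E : Type*} [MeasurableSpace X] {μ : Measure X} [NormedAddCommGroup E]
  [InnerProductSpace ℂ E]

/-- Dominated convergence in `L²`. -/
theorem exists_tendsto_Lp_of_dominated {f : ℕ → Lp E 2 μ} {g : X → E} {bound : X → ℝ}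
    (hb : MemLp bound 2 μ) (h : ∀ n, ∀ᵐ x ∂μ, ‖f n x‖ ≤ bound x)
    (hlim : ∀ᵐ x ∂μ, Filter.Tendsto (fun n => f n x) Filter.atTop (nhds (g x))) :
    ∃ G : Lp E 2 μ, G =ᵐ[μ] g ∧ Filter.Tendsto f Filter.atTop (nhds G) := by
  have hgm : AEStronglyMeasurable g μ :=
    aestronglyMeasurable_of_tendsto_ae Filter.atTop (fun n => Lp.aestronglyMeasurable (f n)) hlim
  have hgb : ∀ᵐ x ∂μ, ‖g x‖ ≤ bound x := by
    filter_upwards [ae_all_iff.2 h, hlim] with x h1 h2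
    exact le_of_tendsto h2.norm (Filter.Eventually.of_forall h1)
  have hg : MemLp g 2 μ := hb.mono' hgm hgb
  refine ⟨hg.toLp, hg.coeFn_toLp, ?_⟩
  have hsq : ∀ n, ‖f n - hg.toLp‖ ^ 2 = ∫ x, ‖f n x - g x‖ ^ 2 ∂μ := by
    intro n
    rw [← inner_self_eq_norm_sq (𝕜 := ℂ)]
    refine (re_inner_eq_integral _ _).trans (integral_congr_ae ?_)
    filter_upwards [Lp.coeFn_sub (f n) hg.toLp, hg.coeFn_toLp] with x h1 h2
    rw [h1, Pi.sub_apply, h2]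
    exact inner_self_eq_norm_sq (𝕜 := ℂ) _
  have hint : Filter.Tendsto (fun n => ∫ x, ‖f n x - g x‖ ^ 2 ∂μ) Filter.atTop (nhds 0) := by
    have h0 : (0 : ℝ) = ∫ _, (0 : ℝ) ∂μ := by simp
    rw [h0]
    refine tendsto_integral_of_dominated_convergence (fun x => (2 * bound x) ^ 2)
      (fun n => (((Lp.aestronglyMeasurable (f n)).sub hgm).norm.pow 2))
      (hb.const_mul 2).integrable_sq (fun n => ?_) ?_
    · filter_upwards [h n, hgb] with x h1 h2
      rw [Real.norm_of_nonneg (sq_nonneg _)]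
      have h3 := norm_sub_le (f n x) (g x)
      gcongr
      linarith
    · filter_upwards [hlim] with x hx
      have h1 := (hx.sub_const (g x)).norm.pow 2
      simpa using h1
  rw [tendsto_iff_norm_sub_tendsto_zero]
  have h2 := (hint.congr fun n => (hsq n).symm).sqrt
  simpa using h2

end DominatedConvergence

/-! ### Removing the regularization -/

section LimitWeight

/-- A sequence of positive regularization parameters that tends to zero. -/
def epsSeq (n : ℕ) : ℝ := 1 / ((n : ℝ) + 1)

theorem epsSeq_pos (n : ℕ) : 0 < epsSeq n := Nat.one_div_pos_of_nat

theorem epsSeq_le_one (n : ℕ) : epsSeq n ≤ 1 := by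
  rw [epsSeq, div_le_one (by positivity)]
  linarith [(Nat.cast_nonneg n : (0 : ℝ) ≤ n)]

theorem tendsto_epsSeq : Filter.Tendsto epsSeq Filter.atTop (nhds 0) :=
  tendsto_one_div_add_atTop_nhds_zero_nat

theorem tendsto_inv_sqrt_epsSeq {x : Plane} (hx : x ≠ 0) :
    Filter.Tendsto (fun n => (√(‖x‖ ^ 2 + epsSeq n ^ 2))⁻¹) Filter.atTop (nhds ‖x‖⁻¹) := by
  have hx' : 0 < ‖x‖ := norm_pos_iff.2 hx
  have h := ((tendsto_const_nhds (x := ‖x‖ ^ 2)).add (tendsto_epsSeq.pow 2)).sqrt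
  rw [zero_pow two_ne_zero, add_zero, Real.sqrt_sq hx'.le] at h
  exact h.inv₀ hx'.ne'

theorem tendsto_planeWeight_epsSeq {x : Plane} (hx : x ≠ 0) :
    Filter.Tendsto (fun n => planeWeight (epsSeq n) (epsSeq n) x) Filter.atTop (nhds ‖x‖) := by
  have hx' : ‖x‖⁻¹ ≠ 0 := inv_ne_zero (norm_ne_zero_iff.2 hx)
  have h := tendsto_epsSeq.add (tendsto_inv_sqrt_epsSeq hx)
  rw [zero_add] at h
  simpa only [inv_inv, planeWeight, radialWeight] using h.inv₀ hx'

theorem tendsto_planeWeightGradient_epsSeq {x : Plane} (hx : x ≠ 0) :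
    Filter.Tendsto (fun n => planeWeightGradient (epsSeq n) (epsSeq n) x) Filter.atTop
      (nhds ((‖x‖⁻¹ ^ 3 * ‖x‖ ^ 2) • x)) :=
  (((tendsto_inv_sqrt_epsSeq hx).pow 3).mul ((tendsto_planeWeight_epsSeq hx).pow 2)).smul_const x

theorem continuous_toLp_momentum :
    Continuous fun v : Plane => (WithLp.toLp 2 fun j => -Complex.I * (v j : ℂ) :
      EuclideanSpace ℂ (Fin 2)) := by
  fun_prop

theorem planeWeight_le_norm_add {ε : ℝ} (hε : 0 < ε) (x : Plane) :
    |planeWeight ε ε x| ≤ ‖x‖ + ε := by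
  rw [planeWeight, abs_of_pos (radialWeight_pos hε _)]
  refine (radialWeight_le_sqrt hε (norm_sq_add_sq_pos x hε)).trans ?_
  exact Real.sqrt_le_iff.2 ⟨by positivity, by nlinarith [norm_nonneg x]⟩

theorem memLp_top_planeWeight_epsSeq (n : ℕ) :
    MemLp (fun x => (planeWeight (epsSeq n) (epsSeq n) x : ℂ)) ⊤ (volume : Measure Plane) :=
  memLp_top_ofReal (contDiff_planeWeight (epsSeq_pos n) (epsSeq_pos n)).continuous
    (abs_planeWeight_le (epsSeq_pos n) _)

theorem ae_ne_zero : ∀ᵐ x ∂(volume : Measure Plane), x ≠ 0 := by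
  rw [ae_iff]
  simp

/-- The regularized weights converge to `|x|` on test functions, in the graph norm of `p + A`. -/
theorem exists_tendsto_mul_norm {A : Plane → Plane}
    {p : WithLp 2 (L2Scalar × L2Vector)} {ψ : Plane → ℂ} (hψ : IsTestFunction ψ)
    (h1 : (p.fst : Plane → ℂ) =ᵐ[volume] ψ)
    (h2 : (p.snd : Plane → EuclideanSpace ℂ (Fin 2)) =ᵐ[volume] magneticMomentum A ψ) :
    ∃ q ∈ (magneticMomentumGraph A).topologicalClosure,
      (q.fst : Plane → ℂ) =ᵐ[volume] (fun x => (‖x‖ : ℂ) * ψ x) ∧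
      Filter.Tendsto (fun n => mulLp (memLp_top_planeWeight_epsSeq n) p.fst) Filter.atTop
        (nhds q.fst) := by
  have hp : p ∈ (magneticMomentumGraph A).topologicalClosure :=
    (magneticMomentumGraph A).le_topologicalClosure ⟨ψ, hψ, h1, h2⟩
  obtain ⟨r, hr⟩ := hψ.2.isBounded.exists_norm_le
  -- On the support the weight is at most `‖x‖ + epsSeq n`, hence at most `|r| + 1`. The absolute
  -- value covers an empty support, for which `r` may be negative.
  have hr0 : 0 ≤ |r| + 1 := by positivity
  have hbound : ∀ n x, x ∈ tsupport ψ →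
      |planeWeight (epsSeq n) (epsSeq n) x| ≤ |r| + 1 := fun n x hx =>
    (planeWeight_le_norm_add (epsSeq_pos n) x).trans
      (add_le_add ((hr x hx).trans (le_abs_self r)) (epsSeq_le_one n))
  have hgb : ∀ n, MemLp (momentumField (planeWeightGradient (epsSeq n) (epsSeq n))) ⊤
      (volume : Measure Plane) := fun n =>
    memLp_top_momentumField
      (contDiff_planeWeightGradient (epsSeq_pos n) (epsSeq_pos n)).continuous
      (norm_planeWeightGradient_le (epsSeq_pos n) (epsSeq_pos n))
  set F : ℕ → L2Scalar := fun n => mulLp (memLp_top_planeWeight_epsSeq n) p.fst with hF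
  set V : ℕ → L2Vector := fun n =>
    mulLp (memLp_top_planeWeight_epsSeq n) p.snd + mulFieldLp (hgb n) p.fst with hV
  obtain ⟨q₁, hq₁, hlim₁⟩ := exists_tendsto_Lp_of_dominated (f := F)
    (g := fun x => (‖x‖ : ℂ) * ψ x) (bound := fun x => (|r| + 1) * ‖p.fst x‖)
    ((Lp.memLp p.fst).norm.const_mul _) (fun n => by
      filter_upwards [coeFn_mulLp (memLp_top_planeWeight_epsSeq n) p.fst, h1] with x e1 e2
      rw [e1, e2, norm_smul, Complex.norm_real, Real.norm_eq_abs]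
      by_cases hx : x ∈ tsupport ψ
      · gcongr
        exact hbound n x hx
      · rw [image_eq_zero_of_notMem_tsupport hx]
        simp) (by
      filter_upwards [ae_all_iff.2 fun n => coeFn_mulLp (memLp_top_planeWeight_epsSeq n) p.fst,
        h1, ae_ne_zero] with x e1 e2 hx
      simp only [hF, e1, e2, smul_eq_mul]
      exact ((Complex.continuous_ofReal.tendsto _).comp
        (tendsto_planeWeight_epsSeq hx)).mul_const _)
  -- Only the existence of an `L²` limit of `D(w_n ψ)` is used: it makes the pairs converge inside
  -- the closed graph. The limit field, with `∇|x| = x / |x|` written as a product of powers, is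
  -- discarded.
  obtain ⟨q₂, -, hlim₂⟩ := exists_tendsto_Lp_of_dominated (f := V)
    (g := fun x => (‖x‖ : ℂ) • magneticMomentum A ψ x
      + ψ x • (WithLp.toLp 2 fun j => -Complex.I * ((((‖x‖⁻¹ ^ 3 * ‖x‖ ^ 2) • x) j : ℝ) : ℂ)))
    (bound := fun x => (|r| + 1) * ‖p.snd x‖ + ‖p.fst x‖)
    (((Lp.memLp p.snd).norm.const_mul _).add (Lp.memLp p.fst).norm) (fun n => by
      filter_upwards [coeFn_mulLp (memLp_top_planeWeight_epsSeq n) p.snd,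
        coeFn_mulFieldLp (hgb n) p.fst, h1, h2, Lp.coeFn_add
          (mulLp (memLp_top_planeWeight_epsSeq n) p.snd) (mulFieldLp (hgb n) p.fst)]
        with x e1 e2 e3 e4 e5
      rw [e5, Pi.add_apply, e1, e2, e3, e4]
      refine (norm_add_le _ _).trans (add_le_add ?_ ?_)
      · rw [norm_smul, Complex.norm_real, Real.norm_eq_abs]
        by_cases hx : x ∈ tsupport ψ
        · gcongr
          exact hbound n x hx
        · have h0 : magneticMomentum A ψ x = 0 := by
            have e6 : fderiv ℝ ψ x = 0 :=
              image_eq_zero_of_notMem_tsupport fun h => hx (tsupport_fderiv_subset ℝ h)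
            ext j
            simp [magneticMomentum, e6, image_eq_zero_of_notMem_tsupport hx]
          rw [h0]
          simp
      · rw [norm_smul, norm_momentumField]
        exact mul_le_of_le_one_right (norm_nonneg _)
          (norm_planeWeightGradient_le (epsSeq_pos n) (epsSeq_pos n) x)) (by
      filter_upwards [ae_all_iff.2 fun n => coeFn_mulLp (memLp_top_planeWeight_epsSeq n) p.snd,
        ae_all_iff.2 fun n => coeFn_mulFieldLp (hgb n) p.fst, h1, h2,
        ae_all_iff.2 fun n => Lp.coeFn_add (mulLp (memLp_top_planeWeight_epsSeq n) p.snd)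
          (mulFieldLp (hgb n) p.fst), ae_ne_zero] with x e1 e2 e3 e4 e5 hx
      simp only [hV, e5, Pi.add_apply, e1, e2, e3, e4]
      exact (((Complex.continuous_ofReal.tendsto _).comp
        (tendsto_planeWeight_epsSeq hx)).smul_const _).add
        (((continuous_toLp_momentum.tendsto _).comp
          (tendsto_planeWeightGradient_epsSeq hx)).const_smul _))
  refine ⟨WithLp.toLp 2 (q₁, q₂), ?_, hq₁, hlim₁⟩
  have hclosed := (magneticMomentumGraph A).isClosed_topologicalClosure
  refine hclosed.mem_of_tendsto (((WithLp.prod_continuous_toLp 2 L2Scalar L2Vector).tendsto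
    (q₁, q₂)).comp (hlim₁.prodMk_nhds hlim₂)) (Filter.Eventually.of_forall fun n => ?_)
  exact mul_mem_closure_magneticMomentumGraph
    (contDiff_planeWeight (epsSeq_pos n) (epsSeq_pos n))
    (fderiv_planeWeight (epsSeq_pos n) (epsSeq_pos n)) _ (hgb n) hp

theorem kineticEnergy_positivity {A : Plane → Plane} (hA : IsL2Loc A) {ψ : Plane → ℂ}
    (hψ : IsTestFunction ψ) :
    ∃ u v : (kineticEnergy A).domain,
      ((u : L2Scalar) : Plane → ℂ) =ᵐ[volume] ψ ∧
      ((v : L2Scalar) : Plane → ℂ) =ᵐ[volume] (fun x => (‖x‖ : ℂ) * ψ x) ∧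
      0 ≤ ⟪(v : L2Scalar), kineticEnergy A u⟫_ℂ + ⟪(u : L2Scalar), kineticEnergy A v⟫_ℂ := by
  have hψ2 : MemLp ψ 2 (volume : Measure Plane) :=
    hψ.1.continuous.memLp_of_hasCompactSupport hψ.2
  have hD2 := memLp_magneticMomentum hA hψ
  set p : WithLp 2 (L2Scalar × L2Vector) := WithLp.toLp 2 (hψ2.toLp, hD2.toLp) with hp
  have hp1 : (p.fst : Plane → ℂ) =ᵐ[volume] ψ := hψ2.coeFn_toLp
  have hp2 : (p.snd : Plane → EuclideanSpace ℂ (Fin 2)) =ᵐ[volume] magneticMomentum A ψ :=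
    hD2.coeFn_toLp
  have hpG : p ∈ (magneticMomentumGraph A).topologicalClosure :=
    (magneticMomentumGraph A).le_topologicalClosure ⟨ψ, hψ, hp1, hp2⟩
  obtain ⟨q, hq, hq1, hlim⟩ := exists_tendsto_mul_norm hψ hp1 hp2
  have hdense : IsDenselyDefinedGraph (magneticMomentumGraph A) := magneticMomentumGraph_dense hA
  obtain ⟨y, hy⟩ := exists_mem_modulusGraph hdense hpG
  obtain ⟨w, hw⟩ := exists_mem_modulusGraph hdense hq
  have hu := hy
  have hv := hw
  rw [← kineticEnergy_graph hA, LinearPMap.mem_graph_iff] at hu hv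
  obtain ⟨u, hu1, hu2⟩ := hu
  obtain ⟨v, hv1, hv2⟩ := hv
  simp only at hu1 hu2 hv1 hv2
  refine ⟨u, v, ?_, ?_, ?_⟩
  · rw [hu1]; exact hp1
  · rw [hv1]; exact hq1
  have hpos : 0 ≤ (⟪q.fst, y⟫_ℂ).re := by
    have hl : Filter.Tendsto
        (fun n => (⟪mulLp (memLp_top_planeWeight_epsSeq n) p.fst, y⟫_ℂ).re) Filter.atTop
        (nhds (⟪q.fst, y⟫_ℂ).re) :=
      (Complex.continuous_re.tendsto _).comp (hlim.inner tendsto_const_nhds)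
    refine ge_of_tendsto hl (Filter.Eventually.of_forall fun n => ?_)
    have h := re_inner_planeWeight_modulus_nonneg hA (epsSeq_pos n) (epsSeq_pos n)
      (memLp_top_planeWeight_epsSeq n) hy
    exact h
  -- By symmetry of the modulus the two terms are complex conjugates, so their sum is real, as the
  -- order on `ℂ` requires, and equals `2 Re ⟨|x| ψ, |D| ψ⟩`.
  have hsymm : ⟪p.fst, w⟫_ℂ = ⟪y, q.fst⟫_ℂ := inner_modulusGraph hy hw
  rw [hu1, hu2, hv1, hv2, hsymm, ← inner_conj_symm y q.fst, Complex.add_conj]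
  exact_mod_cast mul_nonneg zero_le_two hpos

end LimitWeight

/-! ### The planar Laplacian of a function of `‖x‖²` -/

section RadialLaplacian

theorem laplacian_comp_norm_sq {F F₁ F₂ : ℝ → ℝ} (h₀ : ∀ q, HasDerivAt F (F₁ q / 2) q)
    (h₁ : ∀ q, HasDerivAt F₁ (F₂ q / 2) q) (x : Plane) :
    Laplacian.laplacian (fun x : Plane => F (‖x‖ ^ 2)) x
      = 2 * F₁ (‖x‖ ^ 2) + ‖x‖ ^ 2 * F₂ (‖x‖ ^ 2) := by
  have hd : ∀ {f : ℝ → ℝ} {f' : ℝ} {y : Plane}, HasDerivAt f (f' / 2) (‖y‖ ^ 2) →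
      HasFDerivAt (fun x : Plane => f (‖x‖ ^ 2)) (f' • innerSL ℝ y) y := by
    intro f f' y hf
    have h := hasFDerivAt_comp_norm_sq_add_sq (a := 0) (f := f) (f' := f') (x := y)
      (by simpa using hf)
    simpa using h
  -- `innerSL ℝ` is conjugate-linear by type; as the linear map `L` it can be differentiated in its
  -- first argument by the product rule.
  obtain ⟨L, hL⟩ : ∃ L : Plane →L[ℝ] Plane →L[ℝ] ℝ, ∀ y, L y = innerSL ℝ y :=
    ⟨innerSL ℝ, fun _ => rfl⟩
  simp only [← hL] at hd
  have hLs : ∀ (y : Plane) (j : Fin 2), L y (EuclideanSpace.single j 1) = y j := fun y j => by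
    rw [hL, innerSL_single]
  have e1 : fderiv ℝ (fun x : Plane => F (‖x‖ ^ 2)) = fun y => F₁ (‖y‖ ^ 2) • L y :=
    funext fun y => (hd (h₀ _)).fderiv
  have e2 := ((hd (h₁ (‖x‖ ^ 2))).smul L.hasFDerivAt).fderiv
  rw [InnerProductSpace.laplacian_eq_iteratedFDeriv_orthonormalBasis _
    (EuclideanSpace.basisFun (Fin 2) ℝ)]
  have e3 : ∀ j : Fin 2, iteratedFDeriv ℝ 2 (fun x : Plane => F (‖x‖ ^ 2)) x
      ![EuclideanSpace.basisFun (Fin 2) ℝ j, EuclideanSpace.basisFun (Fin 2) ℝ j]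
      = F₁ (‖x‖ ^ 2) + F₂ (‖x‖ ^ 2) * x j ^ 2 := by
    intro j
    have h3 : L (EuclideanSpace.single j (1 : ℝ)) (EuclideanSpace.single j (1 : ℝ)) = (1 : ℝ) := by
      rw [hLs]
      simp
    rw [iteratedFDeriv_two_apply, e1]
    simp only [Matrix.cons_val_zero, Matrix.cons_val_one, EuclideanSpace.basisFun_apply]
    refine (congrArg (fun B : Plane →L[ℝ] Plane →L[ℝ] ℝ => B (EuclideanSpace.single j 1)
      (EuclideanSpace.single j 1)) e2).trans ?_
    simp only [_root_.add_apply, _root_.smul_apply, ContinuousLinearMap.smulRight_apply,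
      h3, hLs, smul_eq_mul]
    ring
  simp only [e3]
  rw [EuclideanSpace.real_norm_sq_eq]
  simp only [Fin.sum_univ_two]
  ring

end RadialLaplacian

/-! ### A logarithmic profile for the non-relativistic counterexample -/

section Profile

/-- A smooth profile on the logarithmic scale that violates the positivity of `|x|p² + p²|x|`. -/
theorem exists_log_profile : ∃ g g₁ g₂ : ℝ → ℝ, ContDiff ℝ ∞ g ∧ HasCompactSupport g ∧
    (∀ s, s ≤ 1 → g s = 0) ∧ (∀ s, HasDerivAt g (g₁ s) s) ∧ (∀ s, HasDerivAt g₁ (g₂ s) s) ∧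
    0 < ∫ r, Real.exp r * (g (2 * r) * g₂ (2 * r)) := by
  -- Centre 3 and outer radius 2 make the bump vanish for `s ≤ 1`, which keeps the final test
  -- function away from the origin.
  let b : ContDiffBump (3 : ℝ) := ⟨1, 2, one_pos, one_lt_two⟩
  set η : ℝ → ℝ := ⇑b with hη
  have hηd : ContDiff ℝ ∞ η := b.contDiff
  have hηc : HasCompactSupport η := b.hasCompactSupport
  have hη0 : ∀ s, s ≤ 1 → η s = 0 := fun s hs => b.zero_of_le_dist (by
    change (2 : ℝ) ≤ dist s 3
    rw [Real.dist_eq, abs_of_nonpos] <;> linarith)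
  have hd1 : ContDiff ℝ ∞ (deriv η) := (contDiff_infty_iff_deriv.1 hηd).2
  have hd2 : ContDiff ℝ ∞ (deriv (deriv η)) := (contDiff_infty_iff_deriv.1 hd1).2
  have h0 : ∀ s, HasDerivAt η (deriv η s) s := fun s =>
    (hηd.differentiable (by simp) s).hasDerivAt
  have h1 : ∀ s, HasDerivAt (deriv η) (deriv (deriv η) s) s := fun s =>
    (hd1.differentiable (by simp) s).hasDerivAt
  have i0 : Integrable fun s => η s * η s :=
    (hηd.continuous.mul hηd.continuous).integrable_of_hasCompactSupport hηc.mul_left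
  have i1 : Integrable fun s => η s * deriv η s :=
    (hηd.continuous.mul hd1.continuous).integrable_of_hasCompactSupport hηc.mul_right
  have i2 : Integrable fun s => η s * deriv (deriv η) s :=
    (hηd.continuous.mul hd2.continuous).integrable_of_hasCompactSupport hηc.mul_right
  have hpos : 0 < ∫ s, η s * η s := by
    refine (hηd.continuous.mul hηd.continuous).integral_pos_of_hasCompactSupport_nonneg_nonzero
      hηc.mul_left (fun s => mul_self_nonneg _) (x := 3) ?_
    have : η 3 = 1 := b.one_of_mem_closedBall (Metric.mem_closedBall_self zero_le_one)
    simp [this]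
  -- As `l → 0` only `∫ η² / 16` survives, so a small `l` works. The bound `l ≤ 1` ensures `l s ≤ 1`
  -- whenever `s ≤ 1`.
  obtain ⟨l, hl0, hl1, hl⟩ : ∃ l : ℝ, 0 < l ∧ l ≤ 1 ∧
      0 < l ^ 2 * (∫ s, η s * deriv (deriv η) s) - l / 2 * (∫ s, η s * deriv η s)
        + 1 / 16 * ∫ s, η s * η s := by
    have hc : Continuous fun l : ℝ => l ^ 2 * (∫ s, η s * deriv (deriv η) s)
        - l / 2 * (∫ s, η s * deriv η s) + 1 / 16 * ∫ s, η s * η s := by fun_prop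
    have hev : ∀ᶠ l : ℝ in nhds 0, 0 < l ^ 2 * (∫ s, η s * deriv (deriv η) s)
        - l / 2 * (∫ s, η s * deriv η s) + 1 / 16 * ∫ s, η s * η s := (hc.tendsto 0).eventually (lt_mem_nhds (a := 0) (by simpa using hpos))
    have hev1 : ∀ᶠ l : ℝ in nhds 0, l ≤ 1 := ge_mem_nhds one_pos
    obtain ⟨l, ⟨h1, h2⟩, h3⟩ := (((hev.and hev1).filter_mono nhdsWithin_le_nhds).and
      (self_mem_nhdsWithin (s := Set.Ioi (0 : ℝ)))).exists
    exact ⟨l, h3, h2, h1⟩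
  have hE : ∀ s : ℝ, HasDerivAt (fun s => Real.exp (-s / 4)) (Real.exp (-s / 4) * (-1 / 4)) s :=
    fun s => ((hasDerivAt_id s).neg.div_const 4).exp
  have hlin : ∀ s : ℝ, HasDerivAt (fun s => l * s) l s := fun s => by
    simpa using (hasDerivAt_id s).const_mul l
  -- At `s = log |x|²` the exponential is `|x|^{-1/2}`. In the integral the two exponentials cancel
  -- `exp r`, and differentiating the exponential twice produces the term `η / 16`.
  refine ⟨fun s => Real.exp (-s / 4) * η (l * s),
    fun s => Real.exp (-s / 4) * (l * deriv η (l * s) - 1 / 4 * η (l * s)),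
    fun s => Real.exp (-s / 4) * (l ^ 2 * deriv (deriv η) (l * s) - l / 2 * deriv η (l * s)
      + 1 / 16 * η (l * s)), ?_, ?_, ?_, ?_, ?_, ?_⟩
  · have : ContDiff ℝ ∞ fun s : ℝ => l * s := contDiff_const.mul contDiff_id
    exact (contDiff_id.neg.div_const 4).exp.mul (hηd.comp this)
  · exact (hηc.comp_homeomorph (Homeomorph.mulLeft₀ l hl0.ne')).mul_left
  · intro s hs
    simp only
    rw [hη0 (l * s) (by nlinarith), mul_zero]
  · intro s
    convert! (hE s).mul ((h0 (l * s)).comp s (hlin s)) using 1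
    simp only [Function.comp]
    ring
  · intro s
    convert! (hE s).mul ((((h1 (l * s)).comp s (hlin s)).const_mul l).sub
      (((h0 (l * s)).comp s (hlin s)).const_mul (1 / 4))) using 1
    simp only [Function.comp, Pi.sub_apply]
    ring
  · have e : ∀ r : ℝ, Real.exp r * (Real.exp (-(2 * r) / 4) * η (l * (2 * r)) *
        (Real.exp (-(2 * r) / 4) * (l ^ 2 * deriv (deriv η) (l * (2 * r))
          - l / 2 * deriv η (l * (2 * r)) + 1 / 16 * η (l * (2 * r)))))
        = (fun s => l ^ 2 * (η s * deriv (deriv η) s) - l / 2 * (η s * deriv η s)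
          + 1 / 16 * (η s * η s)) ((2 * l) * r) := by
      intro r
      have e1 : Real.exp r * (Real.exp (-(2 * r) / 4) * Real.exp (-(2 * r) / 4)) = 1 := by
        rw [← Real.exp_add, ← Real.exp_add, ← Real.exp_zero]
        congr 1
        ring
      rw [show l * (2 * r) = 2 * l * r by ring]
      linear_combination (η (2 * l * r) * (l ^ 2 * deriv (deriv η) (2 * l * r)
          - l / 2 * deriv η (2 * l * r) + 1 / 16 * η (2 * l * r))) * e1
    rw [integral_congr_ae (Filter.Eventually.of_forall e), Measure.integral_comp_mul_left
      (fun s => l ^ 2 * (η s * deriv (deriv η) s) - l / 2 * (η s * deriv η s)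
        + 1 / 16 * (η s * η s)), smul_eq_mul]
    refine mul_pos (abs_pos.2 (by positivity)) ?_
    refine hl.trans_eq ?_
    have i21 := (i2.const_mul (l ^ 2)).sub (i1.const_mul (l / 2))
    refine Eq.symm ((integral_add' i21 (i0.const_mul (1 / 16))).trans ?_)
    rw [integral_sub' (i2.const_mul (l ^ 2)) (i1.const_mul (l / 2))]
    simp only [integral_const_mul]

end Profile

/-! ### Failure of positivity for the Laplacian -/

section NonRelativistic

variable {g g₁ g₂ : ℝ → ℝ}

/-- The formula needs no exception at `q = 0`: near `0` the logarithm is at most `0`, also for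
negative `q` and with `Real.log 0 = 0`, so `u` vanishes there, and the claimed derivative has
denominator `0` and hence value `0`. -/
theorem hasDerivAt_comp_log_div_pow {u u' : ℝ → ℝ} (hu : ∀ s, HasDerivAt u (u' s) s)
    (hu0 : ∀ s, s < 1 → u s = 0) (n : ℕ) (q : ℝ) :
    HasDerivAt (fun q => u (Real.log q) / q ^ n)
      ((u' (Real.log q) - n * u (Real.log q)) / q ^ (n + 1)) q := by
  rcases eq_or_ne q 0 with rfl | hq
  · have h : (fun q => u (Real.log q) / q ^ n) =ᶠ[nhds 0] fun _ => 0 := by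
      filter_upwards [Ioo_mem_nhds (neg_lt_zero.2 one_pos) (zero_lt_one (α := ℝ))] with q hq
      have h1 : Real.log q ≤ 0 := by
        rw [← Real.log_abs]
        exact Real.log_nonpos (abs_nonneg q) (abs_lt.2 ⟨hq.1, hq.2⟩).le
      rw [hu0 _ (h1.trans_lt one_pos), zero_div]
    have h2 := (hasDerivAt_const (0 : ℝ) (0 : ℝ)).congr_of_eventuallyEq h
    simpa using h2
  · have h := ((hu (Real.log q)).comp q (Real.hasDerivAt_log hq)).div (hasDerivAt_pow n q)
      (pow_ne_zero n hq)
    convert! h using 1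
    rcases n with _ | n
    · simp [div_eq_mul_inv]
    · simp only [Function.comp, Nat.add_sub_cancel]
      field_simp
      ring

theorem isTestFunction_comp_log_norm_sq (hg : ContDiff ℝ ∞ g) (hgc : HasCompactSupport g)
    (hg0 : ∀ s, s ≤ 1 → g s = 0) :
    ContDiff ℝ ∞ (fun x : Plane => g (Real.log (‖x‖ ^ 2))) ∧
      HasCompactSupport (fun x : Plane => g (Real.log (‖x‖ ^ 2))) := by
  constructor
  · rw [contDiff_iff_contDiffAt]
    intro x
    rcases eq_or_ne x 0 with rfl | hx
    · have h : (fun x : Plane => g (Real.log (‖x‖ ^ 2))) =ᶠ[nhds 0] fun _ => 0 := by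
        filter_upwards [Metric.ball_mem_nhds (0 : Plane) one_pos] with x hx
        have h1 : Real.log (‖x‖ ^ 2) ≤ 0 :=
          Real.log_nonpos (sq_nonneg _) (pow_le_one₀ (norm_nonneg x) (mem_ball_zero_iff.1 hx).le)
        exact hg0 _ (h1.trans zero_le_one)
      exact contDiffAt_const.congr_of_eventuallyEq h
    · have hx' : ‖x‖ ^ 2 ≠ 0 := pow_ne_zero 2 (norm_ne_zero_iff.2 hx)
      exact hg.contDiffAt.comp x ((contDiff_norm_sq ℝ).contDiffAt.log hx')
  · obtain ⟨r, hr⟩ := hgc.isBounded.exists_norm_le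
    refine HasCompactSupport.intro (isCompact_closedBall 0 (Real.exp |r|)) fun x hx => ?_
    rw [mem_closedBall_zero_iff, not_le] at hx
    refine image_eq_zero_of_notMem_tsupport fun hmem => ?_
    have h1 := (le_abs_self _).trans (hr _ hmem)
    have h2 : |r| < Real.log ‖x‖ := (Real.lt_log_iff_exp_lt ((Real.exp_pos _).trans hx)).2 hx
    rw [Real.log_pow] at h1
    push_cast at h1
    linarith [abs_nonneg r, le_abs_self r]

/-- Since `log |x|²` is harmonic off the origin in the plane, no first derivative of `g` appears;
the factor is `|∇ log |x|²|² = 4 / |x|²`. At the origin both sides are `0`. -/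
theorem laplacian_comp_log_norm_sq (h₀ : ∀ s, HasDerivAt g (g₁ s) s)
    (h₁ : ∀ s, HasDerivAt g₁ (g₂ s) s) (hg0 : ∀ s, s ≤ 1 → g s = 0) (x : Plane) :
    Laplacian.laplacian (fun x : Plane => g (Real.log (‖x‖ ^ 2))) x
      = 4 * g₂ (Real.log (‖x‖ ^ 2)) / ‖x‖ ^ 2 := by
  have hg1 : ∀ s, s < 1 → g₁ s = 0 := by
    intro s hs
    have h : g =ᶠ[nhds s] fun _ => 0 := by
      filter_upwards [gt_mem_nhds hs] with t ht
      exact hg0 t ht.le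
    exact (h₀ s).unique ((hasDerivAt_const s (0 : ℝ)).congr_of_eventuallyEq h)
  have d0 := hasDerivAt_comp_log_div_pow h₀ (fun s hs => hg0 s hs.le) 0
  have d1 := hasDerivAt_comp_log_div_pow h₁ hg1 1
  rw [laplacian_comp_norm_sq (F := fun q => g (Real.log q))
    (F₁ := fun q => 2 * (g₁ (Real.log q) / q ^ 1))
    (F₂ := fun q => 4 * ((g₂ (Real.log q) - 1 * g₁ (Real.log q)) / q ^ 2))
    (fun q => by convert! d0 q using 1 <;> simp)
    (fun q => by
      convert! (d1 q).const_mul 2 using 1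
      push_cast
      ring)]
  rcases eq_or_ne x 0 with rfl | hx
  · simp
  · have : ‖x‖ ≠ 0 := norm_ne_zero_iff.2 hx
    field_simp
    ring

/-- In polar coordinates the factor `|x|` and the area element cancel `1 / |x|²`, and the
substitution `|x| = exp r` brings in `exp r`. The integrand vanishes for `|x| ≤ 1`, so the
half-lines can be exchanged freely. -/
theorem integral_norm_mul_radial_pos (hg0 : ∀ s, s ≤ 1 → g s = 0)
    (hpos : 0 < ∫ r, Real.exp r * (g (2 * r) * g₂ (2 * r))) :
    0 < ∫ x : Plane, ‖x‖ * g (Real.log (‖x‖ ^ 2))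
      * (4 * g₂ (Real.log (‖x‖ ^ 2)) / ‖x‖ ^ 2) := by
  have hvol : 0 < (volume : Measure Plane).real (Metric.ball 0 1) :=
    ENNReal.toReal_pos (Metric.measure_ball_pos volume 0 one_pos).ne' measure_ball_lt_top.ne
  rw [integral_fun_norm_addHaar volume
    (fun y => y * g (Real.log (y ^ 2)) * (4 * g₂ (Real.log (y ^ 2)) / y ^ 2))]
  rw [finrank_euclideanSpace_fin, nsmul_eq_mul, smul_eq_mul]
  refine mul_pos (by norm_num) (mul_pos hvol ?_)
  have hG : ∀ y ∈ Set.Ioi (0 : ℝ), y ^ (2 - 1) • (y * g (Real.log (y ^ 2))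
      * (4 * g₂ (Real.log (y ^ 2)) / y ^ 2))
      = y⁻¹ • (fun r => 4 * (Real.exp r * (g (2 * r) * g₂ (2 * r)))) (Real.log y) := by
    intro y hy
    have hy0 : y ≠ 0 := (Set.mem_Ioi.1 hy).ne'
    simp only [Real.log_pow, Real.exp_log (Set.mem_Ioi.1 hy), smul_eq_mul]
    push_cast
    field_simp
  rw [setIntegral_congr_fun measurableSet_Ioi hG,
    setIntegral_eq_of_subset_of_forall_sdiff_eq_zero (s := Set.Ioi (1 : ℝ)) measurableSet_Ioi
      (Set.Ioi_subset_Ioi zero_le_one), integral_comp_log_Ioi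
      (fun r => 4 * (Real.exp r * (g (2 * r) * g₂ (2 * r)))) one_pos, Real.log_one,
    setIntegral_eq_integral_of_forall_compl_eq_zero, integral_const_mul]
  · positivity
  · intro r hr
    rw [hg0 _ (by linarith [not_lt.1 (Set.mem_Ioi.not.1 hr)])]
    simp
  · intro y hy
    have h1 : Real.log y ≤ 0 := Real.log_nonpos (le_of_lt hy.1) (not_lt.1 hy.2)
    simp only
    rw [hg0 _ (by linarith)]
    simp

theorem nonrelativistic_not_positive : ∃ ψ : Plane → ℂ, IsTestFunction ψ ∧
    (∫ x : Plane, starRingEnd ℂ ((‖x‖ : ℂ) * ψ x) *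
        (-(1 / 2 : ℂ) * Laplacian.laplacian ψ x)) +
      (∫ x : Plane, starRingEnd ℂ (-(1 / 2 : ℂ) * Laplacian.laplacian ψ x) *
        ((‖x‖ : ℂ) * ψ x)) < 0 := by
  obtain ⟨g, g₁, g₂, hg, hgc, hg0, h₀, h₁, hpos⟩ := exists_log_profile
  obtain ⟨hf, hfc⟩ := isTestFunction_comp_log_norm_sq hg hgc hg0
  set f : Plane → ℝ := fun x => g (Real.log (‖x‖ ^ 2)) with hfdef
  have hlap : ∀ x, Laplacian.laplacian (fun x => (f x : ℂ)) x
      = ((4 * g₂ (Real.log (‖x‖ ^ 2)) / ‖x‖ ^ 2 : ℝ) : ℂ) := by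
    intro x
    have h := ContDiffAt.laplacian_CLM_comp_left (l := Complex.ofRealCLM)
      ((contDiff_infty.1 hf 2).contDiffAt (x := x))
    rw [← laplacian_comp_log_norm_sq h₀ h₁ hg0]
    exact h
  refine ⟨fun x => (f x : ℂ), ⟨Complex.ofRealCLM.contDiff.comp hf,
    hfc.comp_left (g := Complex.ofReal) Complex.ofReal_zero⟩, ?_⟩
  have e1 : ∀ x : Plane, starRingEnd ℂ ((‖x‖ : ℂ) * (f x : ℂ)) *
      (-(1 / 2 : ℂ) * Laplacian.laplacian (fun x => (f x : ℂ)) x)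
      = ((-(1 / 2) * (‖x‖ * g (Real.log (‖x‖ ^ 2))
        * (4 * g₂ (Real.log (‖x‖ ^ 2)) / ‖x‖ ^ 2)) : ℝ) : ℂ) := by
    intro x
    rw [hlap, ← Complex.ofReal_mul, Complex.conj_ofReal]
    push_cast
    ring
  have e2 : ∀ x : Plane, starRingEnd ℂ
      (-(1 / 2 : ℂ) * Laplacian.laplacian (fun x => (f x : ℂ)) x) * ((‖x‖ : ℂ) * (f x : ℂ))
      = ((-(1 / 2) * (‖x‖ * g (Real.log (‖x‖ ^ 2))
        * (4 * g₂ (Real.log (‖x‖ ^ 2)) / ‖x‖ ^ 2)) : ℝ) : ℂ) := by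
    intro x
    rw [hlap, show (-(1 / 2 : ℂ)) = ((-(1 / 2) : ℝ) : ℂ) by push_cast; ring, ← Complex.ofReal_mul,
      Complex.conj_ofReal]
    push_cast
    ring
  refine lt_of_eq_of_lt (congrArg₂ (· + ·)
    (integral_congr_ae (Filter.Eventually.of_forall e1))
    (integral_congr_ae (Filter.Eventually.of_forall e2))) ?_
  rw [integral_complex_ofReal, integral_const_mul, ← Complex.ofReal_add, ← Complex.ofReal_zero,
    Complex.real_lt_real]
  linarith [integral_norm_mul_radial_pos hg0 hpos]

end NonRelativistic

end

theorem theorem1 :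
    (∀ A : Plane → Plane, IsL2Loc A →
      ∀ ψ : Plane → ℂ, IsTestFunction ψ →
        ∃ u v : (kineticEnergy A).domain,
          ((u : L2Scalar) : Plane → ℂ) =ᵐ[volume] ψ ∧
          ((v : L2Scalar) : Plane → ℂ) =ᵐ[volume] (fun x => (‖x‖ : ℂ) * ψ x) ∧
          0 ≤ ⟪(v : L2Scalar), kineticEnergy A u⟫_ℂ + ⟪(u : L2Scalar), kineticEnergy A v⟫_ℂ) ∧
    (∃ ψ : Plane → ℂ, IsTestFunction ψ ∧
      (∫ x : Plane, starRingEnd ℂ ((‖x‖ : ℂ) * ψ x) *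
          (-(1 / 2 : ℂ) * Laplacian.laplacian ψ x)) +
        (∫ x : Plane, starRingEnd ℂ (-(1 / 2 : ℂ) * Laplacian.laplacian ψ x) *
          ((‖x‖ : ℂ) * ψ x)) < 0) := by
  exact ⟨fun A hA ψ hψ => kineticEnergy_positivity hA hψ, nonrelativistic_not_positive⟩
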